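/- Let $m,p\ge 1$, $n=m+p$; write $v=(v_-,v_+)\in\mathbb R^m\times\mathbb R^p$ and split $n\times n$ matrices into blocks accordingly. **Data.** Let $\Lambda=\mathrm{diag}(\lambda_1,\dots,\lambda_n)$ be $C^1$ on $\mathbb R^2$, with $\Lambda$ and $\partial_x\Lambda$ bounded, and suppose that there is $\epsilon>0$ such that on $\mathbb R^2$ $$\lambda_1<\dots<\lambda_m<-\epsilon<0<\epsilon<\lambda_{m+1}<\dots<\lambda_n,\qquad \lambda_{i+1}-\lambda_i>\epsilon\quad(1\le i\le n-1).$$ (Speeds given only on $[0,+\infty)\times[0,1]$ are first extended to $\mathbb R^2$ with these properties.) Let $Q^1:[0,+\infty)\to\mathbb R^{p\times m}$ be continuous and bounded, let $G^2_{--}$ and $G^2_{+-}$ be continuous bounded functions on $[0,+\infty)\times[0,1]$ with values in $\mathbb R^{m\times m}$ and $\mathbb R^{p\times m}$, with $G^2_{--}=(g^2_{ij})$ strictly lower triangular, and put $$G^2=\begin{pmatrix}G^2_{--}&0\\ G^2_{+-}&0\end{pmatrix},\qquad G^3=\begin{pmatrix}0&0\\ G^2_{+-}&0\end{pmatrix}.$$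 **Characteristics.** $\chi_i(\cdot;t,x)$ is the solution of $\partial_s\chi_i=\lambda_i(s,\chi_i)$ on $\mathbb R$ with $\chi_i(t;t,x)=x$. For $x\in[0,1]$, $s_i^{in}(t,x)$ and $s_i^{out}(t,x)$ are the times $s$ at which $\chi_i(s;t,x)$ equals $1$ and $0$ respectively if $i\le m$, and $0$ and $1$ respectively if $i>m$. **Broad solutions.** Let $t^0\ge0$, $y^0\in L^2(0,1)^n$. A function $y$ is a broad solution of the system $(0,G,F,Q)$, $$\partial_ty+\Lambda\,\partial_xy=G(t,x)\,y(t,0),\quad y_-(t,1)=\int_0^1F(t,\xi)y(t,\xi)\,d\xi,\quad y_+(t,0)=Q(t)y_-(t,0),\quad y(t^0,\cdot)=y^0,$$ if $y\in C^0([t^0,t^0+T];L^2(0,1)^n)\cap C^0([0,1];L^2(t^0,t^0+T)^n)$ for all $T>0$ and, for every $i$ and a.e. $(t,x)\in(t^0,+\infty)\times(0,1)$, $$y_i(t,x)=b_i(y)(t,x)+\sum_{j=1}^n\int_{\max\{t^0,s_i^{in}(t,x)\}}^t g_{ij}(s,\chi_i(s;t,x))\,y_j(s,0)\,ds.$$ Here,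 with $\sigma=s_i^{in}(t,x)$: $b_i(y)(t,x)=\sum_{j=1}^n\int_0^1f_{ij}(\sigma,\xi)y_j(\sigma,\xi)\,d\xi$ if $\sigma>t^0$ and $i\le m$; $b_i(y)(t,x)=\sum_{j=1}^m q_{i-m,j}(\sigma)y_j(\sigma,0)$ if $\sigma>t^0$ and $i>m$; and $b_i(y)(t,x)=y^0_i(\chi_i(t^0;t,x))$ if $\sigma<t^0$. **Kernel and gain.** Let $H=\begin{pmatrix}H_{--}&0\\0&0\end{pmatrix}$, $H_{--}=(h_{ij})_{1\le i,j\le m}$, where $h_{ij}$ solves the following along characteristics: for all $t>0$, $x,\xi\in(0,1)$ with $s^{out}_i(t,x)\ne s^{out}_j(t,\xi)$, the function $\eta(s)=h_{ij}(s,\chi_i(s;t,x),\chi_j(s;t,\xi))$ satisfies $$\eta'(s)=-\partial_x\lambda_j(s,\chi_j(s;t,\xi))\,\eta(s)\quad\text{for } s\in\bigl[\max\{0,s^{in}_i(t,x),s^{in}_j(t,\xi)\},\ \min\{s^{out}_i(t,x),s^{out}_j(t,\xi)\}\bigr],$$ and the value of $\eta$ at the right endpoint is $0$ if $s^{out}_i(t,x)<s^{out}_j(t,\xi)$,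 and $-g^2_{ij}(\tau,\chi_i(\tau;t,x))/\lambda_j(\tau,0)$ with $\tau=s^{out}_j(t,\xi)$ if $s^{out}_i(t,x)>s^{out}_j(t,\xi)$. (The kernel is in general discontinuous across $s_i^{out}(t,x)=s_j^{out}(t,\xi)$.) Let $F^2\in L^\infty((0,+\infty)\times(0,1))^{m\times n}$ be the solution of $$F^2(t,\xi)-\int_0^1F^2(t,\zeta)H(t,\zeta,\xi)\,d\zeta=-H_-(t,1,\xi)\qquad\text{for a.e. }(t,\xi),$$ where $H_-$ is formed by the first $m$ rows of $H$. **Proposition.** Let $t^0\ge0$, $z^0\in L^2(0,1)^n$, and let $z$ be the broad solution of $(0,G^3,0,Q^1)$ with initial data $z^0$ at time $t^0$. Then $$\gamma(t,x)=z(t,x)-\int_0^1H(t,x,\xi)z(t,\xi)\,d\xi$$ is the broad solution of $(0,G^2,F^2,Q^1)$ with initial data $\gamma^0(x)=z^0(x)-\int_0^1H(t^0,x,\xi)z^0(\xi)\,d\xi$ at time $t^0$. -/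

import Mathlib

open Set Filter Topology MeasureTheory

noncomputable section

/-- Indices of the components of a vector of `ℝⁿ`, `n = m + p`: the `m` components with negative
speed come first (`Sum.inl`), followed by the `p` components with positive speed (`Sum.inr`). -/
abbrev StateIdx (m p : ℕ) : Type := Fin m ⊕ Fin p

/-- The standing assumptions on `Λ = diag(λ₁, …, λₙ)`, where `Λ i t x` is `λᵢ(t,x)` and `Λ` is
already extended to `ℝ²` with its properties preserved:
`C¹` regularity, boundedness of `Λ` and `∂Λ/∂x`, and
`λ₁ < ⋯ < λ_m < -ε < 0 < ε < λ_{m+1} < ⋯ < λ_n` with gaps larger than `ε`. (The gap between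
`λ_m` and `λ_{m+1}` is larger than `2ε` by the sign conditions.) -/
structure AdmissibleSpeeds {m p : ℕ} (Λ : StateIdx m p → ℝ → ℝ → ℝ) : Prop where
  contDiff : ∀ i, ContDiff ℝ 1 (fun q : ℝ × ℝ => Λ i q.1 q.2)
  bounded : ∃ C : ℝ, ∀ i t x, |Λ i t x| ≤ C
  bounded_deriv : ∃ C : ℝ, ∀ i t x, |deriv (Λ i t) x| ≤ C
  speeds : ∃ ε : ℝ, 0 < ε ∧ ∀ t x,
    (∀ i : Fin m, Λ (Sum.inl i) t x < -ε) ∧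
    (∀ i : Fin p, ε < Λ (Sum.inr i) t x) ∧
    (∀ i j : Fin m, i < j → ε < Λ (Sum.inl j) t x - Λ (Sum.inl i) t x) ∧
    (∀ i j : Fin p, i < j → ε < Λ (Sum.inr j) t x - Λ (Sum.inr i) t x)

/-- The flow of a scalar speed `l`: `flow l t x s` is `χ(s;t,x)`, the solution of
`∂χ/∂s = l(s, χ)` for all `s ∈ ℝ`, with `χ(t;t,x) = x`. -/
def flow (l : ℝ → ℝ → ℝ) (t x : ℝ) : ℝ → ℝ :=
  Classical.epsilon fun φ : ℝ → ℝ => φ t = x ∧ ∀ s, HasDerivAt φ (l s (φ s)) s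

/-- The characteristic `χᵢ(s;t,x)`; the arguments are in the order `i s t x`. -/
def chi {m p : ℕ} (Λ : StateIdx m p → ℝ → ℝ → ℝ) (i : StateIdx m p) (s t x : ℝ) : ℝ :=
  flow (Λ i) t x s

/-- The boundary point through which the `i`-th characteristics enter `[0,1]`. -/
def inletPt {m p : ℕ} : StateIdx m p → ℝ
  | Sum.inl _ => 1
  | Sum.inr _ => 0

/-- The boundary point through which the `i`-th characteristics leave `[0,1]`. -/
def outletPt {m p : ℕ} : StateIdx m p → ℝ
  | Sum.inl _ => 0
  | Sum.inr _ => 1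

/-- The entry time of the characteristic `χᵢ(·;t,x)` in `[0,1]`. -/
def entryTime {m p : ℕ} (Λ : StateIdx m p → ℝ → ℝ → ℝ) (i : StateIdx m p) (t x : ℝ) : ℝ :=
  Classical.epsilon fun s : ℝ => chi Λ i s t x = inletPt i

/-- The exit time of the characteristic `χᵢ(·;t,x)` from `[0,1]`. -/
def exitTime {m p : ℕ} (Λ : StateIdx m p → ℝ → ℝ → ℝ) (i : StateIdx m p) (t x : ℝ) : ℝ :=
  Classical.epsilon fun s : ℝ => chi Λ i s t x = outletPt i

/-- `max {t⁰, entry time}`. -/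
def entryTimeFrom {m p : ℕ} (Λ : StateIdx m p → ℝ → ℝ → ℝ) (t0 : ℝ) (i : StateIdx m p)
    (t x : ℝ) : ℝ :=
  max t0 (entryTime Λ i t x)

/-- A real function in `C⁰([0,+∞) × [0,1]) ∩ L^∞((0,+∞) × (0,1))`. -/
def ContBddStrip (g : ℝ → ℝ → ℝ) : Prop :=
  ContinuousOn (fun q : ℝ × ℝ => g q.1 q.2) (Ici 0 ×ˢ Icc 0 1) ∧
    ∃ C : ℝ, ∀ t ∈ Ici (0 : ℝ), ∀ x ∈ Icc (0 : ℝ) 1, |g t x| ≤ C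

/-- A real function in `C⁰([0,+∞)) ∩ L^∞(0,+∞)`. -/
def ContBddHalfLine (q : ℝ → ℝ) : Prop :=
  ContinuousOn q (Ici 0) ∧ ∃ C : ℝ, ∀ t ∈ Ici (0 : ℝ), |q t| ≤ C

/-- A real function in `L^∞((0,+∞) × (0,1))`. -/
def EssBddStrip (f : ℝ → ℝ → ℝ) : Prop :=
  MemLp (fun q : ℝ × ℝ => f q.1 q.2) ⊤ (volume.restrict (Ioi 0 ×ˢ Ioo 0 1))

/-- `f(t,·)` belongs to `L²(A)` for every `t ∈ S`, and `t ↦ f(t,·)` is continuous from `S` to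
`L²(A)`. -/
def ContL2 (S A : Set ℝ) (f : ℝ → ℝ → ℝ) : Prop :=
  (∀ t ∈ S, MemLp (f t) 2 (volume.restrict A)) ∧
    ∀ t ∈ S, Tendsto (fun s => eLpNorm (fun x => f s x - f t x) 2 (volume.restrict A))
      (𝓝[S] t) (𝓝 0)

/-- `y ∈ C⁰([t⁰,t⁰+T]; L²(0,1)ⁿ) ∩ C⁰([0,1]; L²(t⁰,t⁰+T)ⁿ)` for all `T > 0`.
The function `y` is a representative whose slices `y(t,·)`, `t ≥ t⁰`, and `y(·,x)`, `x ∈ [0,1]`,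
are the values of the two continuous maps; such a representative exists for every element of the
intersection, and it gives `y(·,0)` its meaning. Joint measurability ensures that the two
continuous maps come from the same element of `L²`. -/
structure BroadRegularity {m p : ℕ} (t0 : ℝ) (y : ℝ → ℝ → StateIdx m p → ℝ) : Prop where
  measurable : ∀ i, AEStronglyMeasurable (fun q : ℝ × ℝ => y q.1 q.2 i)
    (volume.restrict (Ioi t0 ×ˢ Ioo 0 1))
  cont_time : ∀ i, ∀ T > 0, ContL2 (Icc t0 (t0 + T)) (Ioo 0 1) (fun t x => y t x i)
  cont_space : ∀ i, ∀ T > 0, ContL2 (Icc 0 1) (Ioo t0 (t0 + T)) (fun x t => y t x i)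

/-- The boundary or initial value `bᵢ(y)(t,x)` carried by the characteristic `χᵢ(·;t,x)`. -/
def inflowValue {m p : ℕ} (Λ : StateIdx m p → ℝ → ℝ → ℝ)
    (F : ℝ → ℝ → Matrix (Fin m) (StateIdx m p) ℝ) (Q : ℝ → Matrix (Fin p) (Fin m) ℝ)
    (t0 : ℝ) (y0 : ℝ → StateIdx m p → ℝ) (y : ℝ → ℝ → StateIdx m p → ℝ)
    (i : StateIdx m p) (t x : ℝ) : ℝ :=
  if t0 < entryTime Λ i t x then
    match i with
    | Sum.inl k => ∑ j : StateIdx m p, ∫ ξ in (0 : ℝ)..1,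
        F (entryTime Λ i t x) ξ k j * y (entryTime Λ i t x) ξ j
    | Sum.inr k => ∑ j : Fin m, Q (entryTime Λ i t x) k j * y (entryTime Λ i t x) 0 (Sum.inl j)
  else y0 (chi Λ i t0 t x) i

/-- `y` is a broad solution (solution along the characteristics) of the system `(M,G,F,Q)`
`∂y/∂t + Λ ∂y/∂x = M y + G y(t,0)`, `y₋(t,1) = ∫₀¹ F(t,ξ) y(t,ξ) dξ`, `y₊(t,0) = Q(t) y₋(t,0)`,
`y(t⁰,x) = y⁰(x)`. -/
structure IsBroadSolution {m p : ℕ} (Λ : StateIdx m p → ℝ → ℝ → ℝ)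
    (M G : ℝ → ℝ → Matrix (StateIdx m p) (StateIdx m p) ℝ)
    (F : ℝ → ℝ → Matrix (Fin m) (StateIdx m p) ℝ) (Q : ℝ → Matrix (Fin p) (Fin m) ℝ)
    (t0 : ℝ) (y0 : ℝ → StateIdx m p → ℝ) (y : ℝ → ℝ → StateIdx m p → ℝ) : Prop where
  initial_memLp : ∀ i, MemLp (fun x => y0 x i) 2 (volume.restrict (Ioo 0 1))
  regularity : BroadRegularity t0 y
  equation : ∀ i, ∀ᵐ q : ℝ × ℝ ∂(volume.restrict (Ioi t0 ×ˢ Ioo 0 1)),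
    y q.1 q.2 i = inflowValue Λ F Q t0 y0 y i q.1 q.2
      + ∑ j, (∫ s in (entryTimeFrom Λ t0 i q.1 q.2)..q.1,
          M s (chi Λ i s q.1 q.2) i j * y s (chi Λ i s q.1 q.2) j)
      + ∑ j, (∫ s in (entryTimeFrom Λ t0 i q.1 q.2)..q.1,
          G s (chi Λ i s q.1 q.2) i j * y s 0 j)

/-- The entry time of the characteristic `s ↦ (s, χᵢ(s;t,x), χⱼ(s;t,ξ))`, `i, j ≤ m`, in
`(0,+∞) × (0,1) × (0,1)`. -/
def entryTime₂ {m p : ℕ} (Λ : StateIdx m p → ℝ → ℝ → ℝ) (i j : Fin m) (t x ξ : ℝ) : ℝ :=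
  max 0 (max (entryTime Λ (Sum.inl i) t x) (entryTime Λ (Sum.inl j) t ξ))

/-- The exit time of the characteristic `s ↦ (s, χᵢ(s;t,x), χⱼ(s;t,ξ))`, `i, j ≤ m`, from
`(0,+∞) × (0,1) × (0,1)`. -/
def exitTime₂ {m p : ℕ} (Λ : StateIdx m p → ℝ → ℝ → ℝ) (i j : Fin m) (t x ξ : ℝ) : ℝ :=
  min (exitTime Λ (Sum.inl i) t x) (exitTime Λ (Sum.inl j) t ξ)

/-- The value `b_{ij}(t,x,ξ)` of the kernel at the exit point of the characteristic through
`(t,x,ξ)`: zero if it leaves through `x = 0` first, `-g_{ij}/λⱼ` at the exit point if it leaves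
through `ξ = 0` first. -/
def kernelExitValue {m p : ℕ} (Λ : StateIdx m p → ℝ → ℝ → ℝ)
    (g : ℝ → ℝ → Matrix (Fin m) (Fin m) ℝ) (i j : Fin m) (t x ξ : ℝ) : ℝ :=
  if exitTime Λ (Sum.inl i) t x < exitTime Λ (Sum.inl j) t ξ then 0
  else -(g (exitTime Λ (Sum.inl j) t ξ)
        (chi Λ (Sum.inl i) (exitTime Λ (Sum.inl j) t ξ) t x) i j
      / Λ (Sum.inl j) (exitTime Λ (Sum.inl j) t ξ) 0)

/-- `h = (h_{ij})_{1 ≤ i,j ≤ m}` solves, along the characteristics, the kernel equations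
`∂h_{ij}/∂t + λᵢ(t,x) ∂h_{ij}/∂x + λⱼ(t,ξ) ∂h_{ij}/∂ξ + ∂λⱼ/∂ξ(t,ξ) h_{ij} = 0`,
`h_{ij}(t,0,ξ) = 0`, `h_{ij}(t,x,0) = -g_{ij}(t,x)/λⱼ(t,0)`.
Nothing is required on the characteristics that leave the domain through the edge `x = ξ = 0`:
the kernel is discontinuous there. -/
structure IsKernelSolution {m p : ℕ} (Λ : StateIdx m p → ℝ → ℝ → ℝ)
    (g : ℝ → ℝ → Matrix (Fin m) (Fin m) ℝ)
    (h : ℝ → ℝ → ℝ → Matrix (Fin m) (Fin m) ℝ) : Prop where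
  ode : ∀ (i j : Fin m), ∀ t > 0, ∀ x ∈ Ioo (0 : ℝ) 1, ∀ ξ ∈ Ioo (0 : ℝ) 1,
    exitTime Λ (Sum.inl i) t x ≠ exitTime Λ (Sum.inl j) t ξ →
    ∀ s ∈ Icc (entryTime₂ Λ i j t x ξ) (exitTime₂ Λ i j t x ξ),
      HasDerivWithinAt
        (fun σ => h σ (chi Λ (Sum.inl i) σ t x) (chi Λ (Sum.inl j) σ t ξ) i j)
        (-(deriv (Λ (Sum.inl j) s) (chi Λ (Sum.inl j) s t ξ))
          * h s (chi Λ (Sum.inl i) s t x) (chi Λ (Sum.inl j) s t ξ) i j)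
        (Icc (entryTime₂ Λ i j t x ξ) (exitTime₂ Λ i j t x ξ)) s
  exit_value : ∀ (i j : Fin m), ∀ t > 0, ∀ x ∈ Ioo (0 : ℝ) 1, ∀ ξ ∈ Ioo (0 : ℝ) 1,
    exitTime Λ (Sum.inl i) t x ≠ exitTime Λ (Sum.inl j) t ξ →
    h (exitTime₂ Λ i j t x ξ)
        (chi Λ (Sum.inl i) (exitTime₂ Λ i j t x ξ) t x)
        (chi Λ (Sum.inl j) (exitTime₂ Λ i j t x ξ) t ξ) i j
      = kernelExitValue Λ g i j t x ξ

/-- The full kernel `H`, whose only nonzero block is `H₋₋`. -/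
def fullKernel {m p : ℕ} (h : ℝ → ℝ → ℝ → Matrix (Fin m) (Fin m) ℝ) (t x ξ : ℝ) :
    Matrix (StateIdx m p) (StateIdx m p) ℝ :=
  Matrix.fromBlocks (h t x ξ) 0 0 0

/-- The Fredholm operator at a fixed time: `v(x) - ∫₀¹ K(x,ξ) v(ξ) dξ`. -/
def fredholmSlice {m p : ℕ} (K : ℝ → ℝ → Matrix (StateIdx m p) (StateIdx m p) ℝ)
    (v : ℝ → StateIdx m p → ℝ) (x : ℝ) : StateIdx m p → ℝ :=
  fun i => v x i - ∫ ξ in (0 : ℝ)..1, (Matrix.mulVec (K x ξ) (v ξ)) i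

/-- The Fredholm transformation `γ(t,x) = z(t,x) - ∫₀¹ H(t,x,ξ) z(t,ξ) dξ`. -/
def fredholmTransform {m p : ℕ} (H : ℝ → ℝ → ℝ → Matrix (StateIdx m p) (StateIdx m p) ℝ)
    (z : ℝ → ℝ → StateIdx m p → ℝ) (t x : ℝ) : StateIdx m p → ℝ :=
  fredholmSlice (H t) (z t) x

/-- `F ∈ L^∞((0,+∞) × (0,1))^{m × n}` solves the Fredholm equation
`F(t,ξ) - ∫₀¹ F(t,ζ) H(t,ζ,ξ) dζ = -H₋(t,1,ξ)`, where `H₋` consists of the first `m` rows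
of `H`. -/
structure IsGainSolution {m p : ℕ} (H : ℝ → ℝ → ℝ → Matrix (StateIdx m p) (StateIdx m p) ℝ)
    (F : ℝ → ℝ → Matrix (Fin m) (StateIdx m p) ℝ) : Prop where
  bounded : ∀ i j, EssBddStrip (fun t ξ => F t ξ i j)
  equation : ∀ᵐ q : ℝ × ℝ ∂(volume.restrict (Ioi 0 ×ˢ Ioo 0 1)), ∀ i j,
    F q.1 q.2 i j - (∫ ζ in (0 : ℝ)..1, (F q.1 ζ * H q.1 ζ q.2) i j)
      = -(H q.1 1 q.2 (Sum.inl i) j)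

/-- `G² = (G²₋₋ 0; G²₊₋ 0)`. -/
def sourceMatrix {m p : ℕ} (Gmm : ℝ → ℝ → Matrix (Fin m) (Fin m) ℝ)
    (Gpm : ℝ → ℝ → Matrix (Fin p) (Fin m) ℝ) (t x : ℝ) :
    Matrix (StateIdx m p) (StateIdx m p) ℝ :=
  Matrix.fromBlocks (Gmm t x) 0 (Gpm t x) 0

/-- `G³ = (0 0; G²₊₋ 0)`. -/
def targetMatrix {m p : ℕ} (Gpm : ℝ → ℝ → Matrix (Fin p) (Fin m) ℝ) (t x : ℝ) :
    Matrix (StateIdx m p) (StateIdx m p) ℝ :=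
  Matrix.fromBlocks 0 0 (Gpm t x) 0

end

/-!
The negative components of `z` have no source and no inflow, so they are transported along the
characteristics and vanish once `1` has been reached. On the other hand the kernel `h_ij` is
explicit: along the pair of characteristics it propagates the value `-g_ij / λ_j` taken where the
`j`-th one leaves through `0` before the `i`-th one, and its decay is the Jacobian of the flow of
`λ_j`. Substituting for `ξ` the time at which `χ_j(·;t,ξ)` reaches `0` therefore turns
`∫₀¹ h_ij(t,x,ξ) z_j(t,ξ) dξ` into the integral of `g_ij z_j(·,0)` along `χ_i`, from `t` until its
exit through `0`. Splitting this integral at the entry time gives the equation for `γ`; the part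
which is the value of the transform at `x = 1` is identified, by Fubini and the Fredholm equation,
with the nonlocal boundary condition `∫₀¹ F γ`. The transform changes neither the positive
components nor the trace at `x = 0`, where the integral is empty.
-/

section GlobalODE

variable {E : Type*} [NormedAddCommGroup E] [NormedSpace ℝ E] {v : ℝ → E → E} {t : ℝ} {x : E}

lemma exists_forall_hasDerivAt_of_forall_Ioo {K : NNReal} (hv : ∀ s, LipschitzWith K (v s))
    (hloc : ∀ n : ℕ, ∃ φ : ℝ → E, φ t = x ∧
      ∀ s ∈ Ioo (t - (n + 1)) (t + (n + 1)), HasDerivAt φ (v s (φ s)) s) :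
    ∃ φ : ℝ → E, φ t = x ∧ ∀ s, HasDerivAt φ (v s (φ s)) s := by
  choose φ hφt hφ using hloc
  have heq : ∀ n N : ℕ, n ≤ N → EqOn (φ n) (φ N) (Ioo (t - (n + 1)) (t + (n + 1))) := by
    intro n N hnN
    have : (0 : ℝ) < n + 1 := by positivity
    have hnN' : (n : ℝ) ≤ N := by exact_mod_cast hnN
    exact ODE_solution_unique_of_mem_Ioo (v := v) (s := fun _ => univ) (t₀ := t)
      (fun s _ => (hv s).lipschitzOnWith) ⟨by linarith, by linarith⟩
      (fun s hs => ⟨hφ n s hs, mem_univ _⟩)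
      (fun s hs => ⟨hφ N s ⟨by linarith [hs.1], by linarith [hs.2]⟩, mem_univ _⟩)
      ((hφt n).trans (hφt N).symm)
  have hmem : ∀ s : ℝ, s ∈ Ioo (t - ((⌈|s - t|⌉₊ : ℕ) + 1 : ℝ)) (t + ((⌈|s - t|⌉₊ : ℕ) + 1)) := by
    intro s
    have := abs_le.1 (Nat.le_ceil |s - t|)
    constructor <;> linarith
  refine ⟨fun s => φ ⌈|s - t|⌉₊ s, hφt _, fun s => (hφ _ s (hmem s)).congr_of_eventuallyEq ?_⟩
  filter_upwards [Ioo_mem_nhds (hmem s).1 (hmem s).2] with r hr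
  rcases le_total ⌈|r - t|⌉₊ ⌈|s - t|⌉₊ with h | h
  · exact heq _ _ h (hmem r)
  · exact (heq _ _ h hr).symm

lemma exists_forall_hasDerivAt_of_lipschitzWith [CompleteSpace E] {K C : NNReal}
    (hcont : ∀ y, Continuous fun s => v s y) (hlip : ∀ s, LipschitzWith K (v s))
    (hbound : ∀ s y, ‖v s y‖ ≤ C) (t : ℝ) (x : E) :
    ∃ φ : ℝ → E, φ t = x ∧ ∀ s, HasDerivAt φ (v s (φ s)) s := by
  refine exists_forall_hasDerivAt_of_forall_Ioo hlip fun n => ?_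
  have : (0 : ℝ) < n + 1 := by positivity
  have ht : t ∈ Icc (t - (n + 1)) (t + (n + 1)) := by constructor <;> linarith
  have hpl : IsPicardLindelof v (⟨t, ht⟩ : Icc (t - ((n : ℝ) + 1)) (t + (n + 1))) x
      (C * (n + 1)) 0 C K :=
    { lipschitzOnWith := fun s _ => (hlip s).lipschitzOnWith
      continuousOn := fun y _ => (hcont y).continuousOn
      norm_le := fun s _ y _ => hbound s y
      mul_max_le := by simp }
  obtain ⟨φ, hφt, hφ⟩ := hpl.exists_eq_forall_mem_Icc_hasDerivWithinAt₀
  exact ⟨φ, hφt, fun s hs => (hφ s (Ioo_subset_Icc_self hs)).hasDerivAt (Icc_mem_nhds hs.1 hs.2)⟩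

end GlobalODE

lemma hasDerivAt_mul_of_eq_zero {𝕜 : Type*} [NontriviallyNormedField 𝕜] {u c : 𝕜 → 𝕜} {u' s : 𝕜}
    (hu : HasDerivAt u u' s) (hus : u s = 0) (hc : ContinuousAt c s) :
    HasDerivAt (fun r => u r * c r) (u' * c s) s := by
  rw [hasDerivAt_iff_tendsto_slope] at hu ⊢
  refine (hu.mul (hc.tendsto.mono_left nhdsWithin_le_nhds)).congr fun r => ?_
  simp only [slope_def_field, hus, zero_mul, sub_zero]
  ring

/-- A `C¹` speed, bounded by `C`, whose space derivative is bounded by `K`. -/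
structure RegularSpeed (l : ℝ → ℝ → ℝ) (C K : ℝ) : Prop where
  contDiff : ContDiff ℝ 1 (fun q : ℝ × ℝ => l q.1 q.2)
  bound : ∀ t x, |l t x| ≤ C
  deriv_bound : ∀ t x, |deriv (l t) x| ≤ K

/-- The averaged space derivative of `l s` between two states `y'` and `y`. It makes the
difference of two solutions of `φ' = l(s, φ)` the solution of a linear equation. -/
noncomputable def meanDeriv (l : ℝ → ℝ → ℝ) (s y y' : ℝ) : ℝ :=
  ∫ θ in (0 : ℝ)..1, deriv (l s) (y' + θ * (y - y'))

lemma meanDeriv_self (l : ℝ → ℝ → ℝ) (s y : ℝ) : meanDeriv l s y y = deriv (l s) y := by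
  simp [meanDeriv]

namespace RegularSpeed

variable {l : ℝ → ℝ → ℝ} {C K : ℝ}

lemma K_nonneg (hl : RegularSpeed l C K) : 0 ≤ K := (abs_nonneg _).trans (hl.deriv_bound 0 0)

lemma continuous (hl : RegularSpeed l C K) : Continuous fun q : ℝ × ℝ => l q.1 q.2 :=
  hl.contDiff.continuous

lemma hasDerivAt (hl : RegularSpeed l C K) (s x : ℝ) :
    HasDerivAt (l s) (fderiv ℝ (fun q : ℝ × ℝ => l q.1 q.2) (s, x) (0, 1)) x :=
  (hl.contDiff.differentiable one_ne_zero (s, x)).hasFDerivAt.comp_hasDerivAt x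
    ((hasDerivAt_const x s).prodMk (hasDerivAt_id x))

lemma differentiable (hl : RegularSpeed l C K) (s : ℝ) : Differentiable ℝ (l s) :=
  fun x => (hl.hasDerivAt s x).differentiableAt

lemma continuous_deriv (hl : RegularSpeed l C K) :
    Continuous fun q : ℝ × ℝ => deriv (l q.1) q.2 := by
  simp only [fun q : ℝ × ℝ => (hl.hasDerivAt q.1 q.2).deriv]
  exact (hl.contDiff.continuous_fderiv one_ne_zero).clm_apply continuous_const

lemma lipschitzWith (hl : RegularSpeed l C K) (s : ℝ) :
    LipschitzWith (Real.toNNReal K) (l s) :=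
  lipschitzWith_of_nnnorm_deriv_le (hl.differentiable s) fun x =>
    NNReal.le_toNNReal_of_coe_le (hl.deriv_bound s x)

lemma continuous_meanDeriv (hl : RegularSpeed l C K) :
    Continuous fun q : ℝ × ℝ × ℝ => meanDeriv l q.1 q.2.1 q.2.2 :=
  intervalIntegral.continuous_parametric_intervalIntegral_of_continuous'
    (f := fun (q : ℝ × ℝ × ℝ) θ => deriv (l q.1) (q.2.2 + θ * (q.2.1 - q.2.2)))
    (hl.continuous_deriv.comp (f := fun p : (ℝ × ℝ × ℝ) × ℝ =>
      (p.1.1, p.1.2.2 + p.2 * (p.1.2.1 - p.1.2.2))) (by fun_prop)) _ _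

lemma abs_meanDeriv_le (hl : RegularSpeed l C K) (s y y' : ℝ) : |meanDeriv l s y y'| ≤ K := by
  simpa [meanDeriv] using intervalIntegral.norm_integral_le_of_norm_le_const (a := 0) (b := 1)
    (f := fun θ => deriv (l s) (y' + θ * (y - y'))) (fun _ _ => hl.deriv_bound _ _)

lemma sub_eq_meanDeriv_mul (hl : RegularSpeed l C K) (s y y' : ℝ) :
    l s y - l s y' = meanDeriv l s y y' * (y - y') := by
  have hcont : Continuous fun θ : ℝ => deriv (l s) (y' + θ * (y - y')) :=
    hl.continuous_deriv.comp (f := fun θ : ℝ => (s, y' + θ * (y - y'))) (by fun_prop)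
  have h := intervalIntegral.integral_unitInterval_deriv_eq_sub (𝕜 := ℝ) (f := l s) (z₀ := y')
    (z₁ := y - y') hcont.continuousOn fun θ _ => (hl.differentiable s _).hasDerivAt
  rw [add_sub_cancel, smul_eq_mul] at h
  rw [← h, meanDeriv, mul_comm]
  simp only [smul_eq_mul]

lemma sub_eq_mul_exp (hl : RegularSpeed l C K) {φ ψ : ℝ → ℝ}
    (hφ : ∀ s, HasDerivAt φ (l s (φ s)) s) (hψ : ∀ s, HasDerivAt ψ (l s (ψ s)) s) (t s : ℝ) :
    φ s - ψ s = (φ t - ψ t) * Real.exp (∫ r in t..s, meanDeriv l r (φ r) (ψ r)) := by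
  have hφc : Continuous φ := continuous_iff_continuousAt.2 fun s => (hφ s).continuousAt
  have hψc : Continuous ψ := continuous_iff_continuousAt.2 fun s => (hψ s).continuousAt
  have hmean : Continuous fun r => meanDeriv l r (φ r) (ψ r) :=
    hl.continuous_meanDeriv.comp (f := fun r => (r, φ r, ψ r)) (by fun_prop)
  set E := fun s => (φ s - ψ s) * Real.exp (-∫ r in t..s, meanDeriv l r (φ r) (ψ r)) with hE
  have hE' : ∀ s, HasDerivAt E 0 s := fun s => by
    refine (((hφ s).fun_sub (hψ s)).fun_mul
      ((hmean.integral_hasStrictDerivAt t s).hasDerivAt.fun_neg.exp)).congr_deriv ?_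
    rw [hl.sub_eq_meanDeriv_mul]
    ring
  have hconst : E s = φ t - ψ t := by
    rw [is_const_of_deriv_eq_zero (fun s => (hE' s).differentiableAt) (fun s => (hE' s).deriv) s t]
    simp [hE]
  rw [← hconst, mul_assoc, ← Real.exp_add, neg_add_cancel, Real.exp_zero, mul_one]

lemma flow_spec (hl : RegularSpeed l C K) (t x : ℝ) :
    flow l t x t = x ∧ ∀ s, HasDerivAt (flow l t x) (l s (flow l t x s)) s :=
  Classical.epsilon_spec (exists_forall_hasDerivAt_of_lipschitzWith
    (fun y => hl.continuous.comp (f := fun s : ℝ => (s, y)) (by fun_prop)) hl.lipschitzWith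
    (fun s y => (hl.bound s y).trans (Real.le_coe_toNNReal C)) t x)

lemma flow_self (hl : RegularSpeed l C K) (t x : ℝ) : flow l t x t = x := (hl.flow_spec t x).1

lemma hasDerivAt_flow (hl : RegularSpeed l C K) (t x s : ℝ) :
    HasDerivAt (flow l t x) (l s (flow l t x s)) s := (hl.flow_spec t x).2 s

lemma continuous_flow_time (hl : RegularSpeed l C K) (t x : ℝ) : Continuous (flow l t x) :=
  continuous_iff_continuousAt.2 fun s => (hl.hasDerivAt_flow t x s).continuousAt

lemma flow_sub_flow (hl : RegularSpeed l C K) (t x t' x' r s : ℝ) :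
    flow l t x s - flow l t' x' s = (flow l t x r - flow l t' x' r)
      * Real.exp (∫ ρ in r..s, meanDeriv l ρ (flow l t x ρ) (flow l t' x' ρ)) :=
  hl.sub_eq_mul_exp (hl.hasDerivAt_flow t x) (hl.hasDerivAt_flow t' x') r s

lemma flow_flow (hl : RegularSpeed l C K) (t x r s : ℝ) :
    flow l r (flow l t x r) s = flow l t x s := by
  have h := hl.flow_sub_flow r (flow l t x r) t x r s
  rwa [hl.flow_self, sub_self, zero_mul, sub_eq_zero] at h

lemma flow_lt_flow_iff (hl : RegularSpeed l C K) (t x t' x' r s : ℝ) :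
    flow l t x s < flow l t' x' s ↔ flow l t x r < flow l t' x' r := by
  rw [← sub_neg, hl.flow_sub_flow t x t' x' r s, ← zero_mul (Real.exp _),
    mul_lt_mul_iff_left₀ (Real.exp_pos _), sub_neg]

lemma abs_integral_meanDeriv_le (hl : RegularSpeed l C K) (φ ψ : ℝ → ℝ) (r s : ℝ) :
    |∫ ρ in r..s, meanDeriv l ρ (φ ρ) (ψ ρ)| ≤ K * |s - r| :=
  intervalIntegral.norm_integral_le_of_norm_le_const
    (f := fun ρ => meanDeriv l ρ (φ ρ) (ψ ρ)) fun _ _ => hl.abs_meanDeriv_le _ _ _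

lemma abs_flow_sub_flow_le (hl : RegularSpeed l C K) (t x t' x' r s : ℝ) :
    |flow l t x s - flow l t' x' s| ≤
      |flow l t x r - flow l t' x' r| * Real.exp (K * |s - r|) := by
  rw [hl.flow_sub_flow t x t' x' r s, abs_mul, Real.abs_exp]
  gcongr
  exact (le_abs_self _).trans (hl.abs_integral_meanDeriv_le _ _ _ _)

lemma abs_flow_sub_le (hl : RegularSpeed l C K) (t x s s' : ℝ) :
    |flow l t x s - flow l t x s'| ≤ C * |s - s'| :=
  Convex.norm_image_sub_le_of_norm_hasDerivWithin_le (s := univ)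
    (fun r _ => (hl.hasDerivAt_flow t x r).hasDerivWithinAt) (fun _ _ => hl.bound _ _)
    convex_univ (mem_univ s') (mem_univ s)

lemma dist_flow_flow_le (hl : RegularSpeed l C K) (t x s t' x' s' : ℝ) :
    dist (flow l t' x' s') (flow l t x s) ≤
      (C * |t - t'| + |x' - x|) * Real.exp (K * |s' - t|) + C * |s' - s| := by
  have hstart : |flow l t' x' t - flow l t x t| ≤ C * |t - t'| + |x' - x| := by
    have h := (abs_sub_le (flow l t' x' t) (flow l t' x' t') x).trans
      (add_le_add_left (hl.abs_flow_sub_le t' x' t t') _)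
    simpa only [hl.flow_self] using h
  calc dist (flow l t' x' s') (flow l t x s)
      ≤ |flow l t' x' s' - flow l t x s'| + |flow l t x s' - flow l t x s| := abs_sub_le _ _ _
    _ ≤ |flow l t' x' t - flow l t x t| * Real.exp (K * |s' - t|) + C * |s' - s| :=
        add_le_add (hl.abs_flow_sub_flow_le t' x' t x t s') (hl.abs_flow_sub_le t x s' s)
    _ ≤ _ := by gcongr

lemma continuous_flow (hl : RegularSpeed l C K) :
    Continuous fun q : ℝ × ℝ × ℝ => flow l q.1 q.2.1 q.2.2 := by
  refine continuous_iff_continuousAt.2 fun ⟨t, x, s⟩ => tendsto_iff_dist_tendsto_zero.2 ?_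
  refine squeeze_zero (fun _ => dist_nonneg) (fun q => hl.dist_flow_flow_le t x s _ _ _) ?_
  have h : Continuous fun q : ℝ × ℝ × ℝ =>
      (C * |t - q.1| + |q.2.1 - x|) * Real.exp (K * |q.2.2 - t|) + C * |q.2.2 - s| := by fun_prop
  simpa using h.tendsto (t, x, s)

lemma hasDerivAt_flow_initialTime (hl : RegularSpeed l C K) (t y s : ℝ) :
    HasDerivAt (fun s => flow l s y t)
      (-(l s y) * Real.exp (∫ r in s..t, deriv (l r) (flow l s y r))) s := by
  have hgap : ∀ s', flow l s' y t = flow l s y t + (y - flow l s y s') *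
      Real.exp (-∫ r in t..s', meanDeriv l r (flow l s' y r) (flow l s y r)) := fun s' => by
    have h := hl.flow_sub_flow s' y s y s' t
    rw [hl.flow_self, intervalIntegral.integral_symm] at h
    linarith
  have hexp : Continuous fun s' =>
      Real.exp (-∫ r in t..s', meanDeriv l r (flow l s' y r) (flow l s y r)) := by
    refine Real.continuous_exp.comp (Continuous.neg ?_)
    refine intervalIntegral.continuous_parametric_intervalIntegral_of_continuous ?_ continuous_id
    refine hl.continuous_meanDeriv.comp (f := fun p : ℝ × ℝ =>
      (p.2, flow l p.1 y p.2, flow l s y p.2)) (continuous_snd.prodMk (.prodMk ?_ ?_))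
    · exact hl.continuous_flow.comp (f := fun p : ℝ × ℝ => (p.1, y, p.2)) (by fun_prop)
    · exact (hl.continuous_flow_time s y).comp continuous_snd
  have hderiv : HasDerivAt (fun s' => y - flow l s y s') (-(l s y)) s := by
    simpa only [hl.flow_self] using (hl.hasDerivAt_flow s y s).const_sub y
  have h := (hasDerivAt_mul_of_eq_zero hderiv (by rw [hl.flow_self, sub_self])
    hexp.continuousAt).const_add (flow l s y t)
  simp only [meanDeriv_self] at h
  rw [intervalIntegral.integral_symm t s]
  exact h.congr_of_eventuallyEq (.of_forall hgap)

end RegularSpeed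

/-- The time at which the characteristic `flow l t x` passes through `y`. -/
noncomputable def hitTime (l : ℝ → ℝ → ℝ) (y t x : ℝ) : ℝ :=
  Classical.epsilon fun s : ℝ => flow l t x s = y

/-- A regular speed bounded above by `-ε < 0`. -/
structure NegativeSpeed (l : ℝ → ℝ → ℝ) (C K ε : ℝ) : Prop extends RegularSpeed l C K where
  pos : 0 < ε
  lt_neg : ∀ t x, l t x < -ε

namespace NegativeSpeed

variable {l : ℝ → ℝ → ℝ} {C K ε : ℝ}

lemma flow_add_le (hl : NegativeSpeed l C K ε) (t x : ℝ) {s s' : ℝ} (h : s ≤ s') :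
    flow l t x s' + ε * (s' - s) ≤ flow l t x s := by
  have hderiv : ∀ s, HasDerivAt (fun s => flow l t x s + ε * s) (l s (flow l t x s) + ε) s :=
    fun s => ((hl.hasDerivAt_flow t x s).fun_add
      ((hasDerivAt_id s).const_mul ε)).congr_deriv (by simp)
  have hanti : Antitone fun s => flow l t x s + ε * s :=
    antitone_of_hasDerivAt_nonpos hderiv fun s => by
      simp only [Pi.zero_apply]
      linarith [hl.lt_neg s (flow l t x s)]
  linarith [hanti h]

lemma mul_abs_sub_le (hl : NegativeSpeed l C K ε) (t x s s' : ℝ) :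
    ε * |s - s'| ≤ |flow l t x s - flow l t x s'| := by
  wlog h : s ≤ s' generalizing s s'
  · rw [abs_sub_comm, abs_sub_comm (flow l t x s)]
    exact this s' s (le_of_not_ge h)
  · rw [abs_of_nonpos (sub_nonpos.2 h)]
    exact le_trans (by linarith [hl.flow_add_le t x h]) (le_abs_self _)

lemma flow_strictAnti (hl : NegativeSpeed l C K ε) (t x : ℝ) : StrictAnti (flow l t x) :=
  fun s s' h => by linarith [hl.flow_add_le t x h.le, mul_pos hl.pos (sub_pos.2 h)]

lemma exists_flow_eq (hl : NegativeSpeed l C K ε) (t x y : ℝ) : ∃ s, flow l t x s = y := by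
  have hε := hl.pos
  have hδ : 0 ≤ |x - y| / ε := by positivity
  have hεδ : ε * (|x - y| / ε) = |x - y| := by field_simp
  have hright := hl.flow_add_le t x (s := t) (s' := t + |x - y| / ε) (by linarith)
  have hleft := hl.flow_add_le t x (s := t - |x - y| / ε) (s' := t) (by linarith)
  rw [hl.flow_self, add_sub_cancel_left, hεδ] at hright
  rw [hl.flow_self, sub_sub_cancel, hεδ] at hleft
  obtain ⟨s, -, hs⟩ := intermediate_value_Icc' (a := t - |x - y| / ε) (b := t + |x - y| / ε)
    (by linarith) (hl.continuous_flow_time t x).continuousOn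
    (show y ∈ Icc _ _ from
      ⟨by linarith [le_abs_self (x - y)], by linarith [neg_abs_le (x - y)]⟩)
  exact ⟨s, hs⟩

lemma flow_hitTime (hl : NegativeSpeed l C K ε) (y t x : ℝ) :
    flow l t x (hitTime l y t x) = y :=
  Classical.epsilon_spec (hl.exists_flow_eq t x y)

lemma lt_hitTime_iff (hl : NegativeSpeed l C K ε) (y t x s : ℝ) :
    s < hitTime l y t x ↔ y < flow l t x s := by
  conv_rhs => rw [← hl.flow_hitTime y t x]
  exact (hl.flow_strictAnti t x).lt_iff_gt.symm

lemma hitTime_lt_iff (hl : NegativeSpeed l C K ε) (y t x s : ℝ) :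
    hitTime l y t x < s ↔ flow l t x s < y := by
  conv_rhs => rw [← hl.flow_hitTime y t x]
  exact (hl.flow_strictAnti t x).lt_iff_gt.symm

lemma le_hitTime_iff (hl : NegativeSpeed l C K ε) (y t x s : ℝ) :
    s ≤ hitTime l y t x ↔ y ≤ flow l t x s := by
  rw [← not_lt, hl.hitTime_lt_iff, not_lt]

lemma hitTime_le_iff (hl : NegativeSpeed l C K ε) (y t x s : ℝ) :
    hitTime l y t x ≤ s ↔ flow l t x s ≤ y := by
  rw [← not_lt, hl.lt_hitTime_iff, not_lt]

lemma flow_mem_Icc_iff (hl : NegativeSpeed l C K ε) (a b t x s : ℝ) :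
    flow l t x s ∈ Icc a b ↔ s ∈ Icc (hitTime l b t x) (hitTime l a t x) := by
  rw [mem_Icc, mem_Icc, hl.le_hitTime_iff, hl.hitTime_le_iff, and_comm]

lemma hitTime_eq (hl : NegativeSpeed l C K ε) {y t x s : ℝ} (h : flow l t x s = y) :
    hitTime l y t x = s :=
  (hl.flow_strictAnti t x).injective ((hl.flow_hitTime y t x).trans h.symm)

lemma hitTime_flow (hl : NegativeSpeed l C K ε) (y t x s : ℝ) :
    hitTime l y s (flow l t x s) = hitTime l y t x :=
  hl.hitTime_eq (by rw [hl.flow_flow, hl.flow_hitTime])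

lemma hitTime_self (hl : NegativeSpeed l C K ε) (t x : ℝ) : hitTime l x t x = t :=
  hl.hitTime_eq (hl.flow_self t x)

lemma flow_initialTime_hitTime (hl : NegativeSpeed l C K ε) (y t x : ℝ) :
    flow l (hitTime l y t x) y t = x := by
  have h := hl.flow_flow t x (hitTime l y t x) t
  rwa [hl.flow_hitTime, hl.flow_self] at h

lemma hitTime_initialTime (hl : NegativeSpeed l C K ε) (y s t : ℝ) :
    hitTime l y t (flow l s y t) = s := by
  rw [hl.hitTime_flow, hl.hitTime_self]

lemma continuous_hitTime (hl : NegativeSpeed l C K ε) (y : ℝ) :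
    Continuous fun q : ℝ × ℝ => hitTime l y q.1 q.2 := by
  refine continuous_iff_continuousAt.2 fun ⟨t, x⟩ => tendsto_iff_dist_tendsto_zero.2 ?_
  have hle : ∀ q : ℝ × ℝ, dist (hitTime l y q.1 q.2) (hitTime l y t x) ≤
      |y - flow l q.1 q.2 (hitTime l y t x)| / ε := fun q => by
    rw [le_div_iff₀ hl.pos, mul_comm]
    have h := hl.mul_abs_sub_le q.1 q.2 (hitTime l y q.1 q.2) (hitTime l y t x)
    rwa [hl.flow_hitTime] at h
  refine squeeze_zero (fun _ => dist_nonneg) hle ?_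
  have hc : Continuous fun q : ℝ × ℝ => |y - flow l q.1 q.2 (hitTime l y t x)| / ε :=
    (continuous_const.sub (hl.continuous_flow.comp
      (f := fun q : ℝ × ℝ => (q.1, q.2, hitTime l y t x)) (by fun_prop))).abs.div_const _
  simpa [hl.flow_hitTime] using hc.tendsto (t, x)

lemma abs_sub_le_mul_flow_initialTime (hl : NegativeSpeed l C K ε) (t x s s' : ℝ) :
    |s - s'| ≤ ε⁻¹ * Real.exp (K * |s - t|) * |flow l s x t - flow l s' x t| := by
  have hspread := hl.abs_flow_sub_flow_le s x s' x t s
  have hspeed := hl.mul_abs_sub_le s' x s' s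
  rw [hl.flow_self, abs_sub_comm] at hspeed
  rw [hl.flow_self] at hspread
  rw [mul_assoc, inv_mul_eq_div, le_div_iff₀ hl.pos]
  linarith

lemma flow_initialTime_strictMono (hl : NegativeSpeed l C K ε) (t y : ℝ) :
    StrictMono fun s => flow l s y t := by
  intro s s' h
  have hlt := hl.flow_strictAnti s' y h
  rw [hl.flow_self] at hlt
  exact (hl.flow_lt_flow_iff s y s' y s t).2 (by rwa [hl.flow_self])

lemma image_flow_initialTime_Ioi (hl : NegativeSpeed l C K ε) (y t : ℝ) :
    (fun s => flow l s y t) '' Ioi t = Ioi y := by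
  refine Subset.antisymm ?_ fun ξ hξ => ⟨hitTime l y t ξ, ?_, hl.flow_initialTime_hitTime y t ξ⟩
  · rintro _ ⟨s, hs, rfl⟩
    simpa only [hl.flow_self, mem_Ioi] using hl.flow_initialTime_strictMono t y hs
  · exact (hl.lt_hitTime_iff y t ξ t).2 (by rwa [hl.flow_self])

lemma ae_hitTime (hl : NegativeSpeed l C K ε) (y t : ℝ) {P : ℝ → Prop} (hP : ∀ᵐ s, P s) :
    ∀ᵐ x, P (hitTime l y t x) := by
  have hnull : volume ((fun s => flow l s y t) '' {s | ¬P s}) = 0 :=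
    addHaar_image_eq_zero_of_differentiableOn_of_addHaar_eq_zero volume (fun s _ =>
      (hl.hasDerivAt_flow_initialTime t y s).differentiableAt.differentiableWithinAt) hP
  refine measure_mono_null (fun x hx => ?_) hnull
  exact ⟨hitTime l y t x, hx, hl.flow_initialTime_hitTime y t x⟩

end NegativeSpeed

open scoped Measure ENNReal NNReal in
lemma map_restrict_hausdorffMeasure_le {E E' : Type*} [MetricSpace E] [MeasurableSpace E]
    [BorelSpace E] [MetricSpace E'] [MeasurableSpace E'] [BorelSpace E'] {d : ℝ} (hd : 0 ≤ d)
    {X : E → E'} (hX : Measurable X) {A : Set E} {L : ℝ≥0}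
    (hXA : AntilipschitzWith L (A.domRestrict X)) :
    (μH[d].restrict A).map X ≤ ((L : ℝ≥0∞) ^ d) • (μH[d] : Measure E') := by
  refine Measure.le_iff.2 fun B hB => ?_
  have hpre : X ⁻¹' B ∩ A = Subtype.val '' (A.domRestrict X ⁻¹' B) := by
    ext s
    simp [and_comm]
  rw [Measure.map_apply hX hB, Measure.restrict_apply (hX hB), hpre,
    isometry_subtype_coe.hausdorffMeasure_image (Or.inl hd)]
  exact hXA.hausdorffMeasure_preimage_le hd B

lemma map_restrict_volume_le {X : ℝ → ℝ} (hX : Measurable X) {A : Set ℝ} {L : ℝ} (hL : 0 ≤ L)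
    (hXA : ∀ s ∈ A, ∀ s' ∈ A, |s - s'| ≤ L * |X s - X s'|) :
    (volume.restrict A).map X ≤ ENNReal.ofReal L • (volume : Measure ℝ) := by
  have hanti : AntilipschitzWith (Real.toNNReal L) (A.domRestrict X) :=
    AntilipschitzWith.of_le_mul_dist fun s s' => by
      rw [Real.coe_toNNReal L hL]
      exact hXA s s.2 s' s'.2
  have h := map_restrict_hausdorffMeasure_le zero_le_one hX hanti
  rwa [hausdorffMeasure_real, ENNReal.rpow_one] at h

section CompositionInLp

open scoped ENNReal NNReal

variable {α β E : Type*} [MeasurableSpace α] [MeasurableSpace β] [NormedAddCommGroup E]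
  {μ : Measure α} {ν : Measure β} {p c : ℝ≥0∞} {f : β → E} {Y : α → β}

lemma aestronglyMeasurable_comp_of_map_le_smul (hY : AEMeasurable Y μ) (hYc : μ.map Y ≤ c • ν)
    (hf : AEStronglyMeasurable f ν) : AEStronglyMeasurable (f ∘ Y) μ :=
  ((hf.smul_measure c).mono_measure hYc).comp_aemeasurable hY

lemma eLpNorm_comp_le_of_map_le_smul (hp : p ≠ ∞) (hY : AEMeasurable Y μ)
    (hYc : μ.map Y ≤ c • ν) (hf : AEStronglyMeasurable f ν) :
    eLpNorm (f ∘ Y) p μ ≤ c ^ (1 / p).toReal * eLpNorm f p ν := by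
  rw [← eLpNorm_map_measure ((hf.smul_measure c).mono_measure hYc) hY, ← smul_eq_mul,
    ← eLpNorm_smul_measure_of_ne_top hp]
  exact eLpNorm_mono_measure f hYc

lemma memLp_comp_of_map_le_smul (hp : p ≠ ∞) (hc : c ≠ ∞) (hY : AEMeasurable Y μ)
    (hYc : μ.map Y ≤ c • ν) (hf : MemLp f p ν) : MemLp (f ∘ Y) p μ :=
  ⟨aestronglyMeasurable_comp_of_map_le_smul hY hYc hf.1,
    (eLpNorm_comp_le_of_map_le_smul hp hY hYc hf.1).trans_lt (ENNReal.mul_lt_top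
      (ENNReal.rpow_lt_top_of_nonneg ENNReal.toReal_nonneg hc) hf.2)⟩

variable {ι : Type*} {l : Filter ι} [l.IsCountablyGenerated] [IsFiniteMeasure μ]

lemma tendsto_eLpNorm_zero_of_bounded (hp0 : p ≠ 0) (hp : p ≠ ∞) {u : ι → α → E} {M : ℝ≥0}
    (hu : ∀ i, AEStronglyMeasurable (u i) μ) (huM : ∀ i x, ‖u i x‖₊ ≤ M)
    (hlim : ∀ᵐ x ∂μ, Tendsto (fun i => u i x) l (𝓝 0)) :
    Tendsto (fun i => eLpNorm (u i) p μ) l (𝓝 0) := by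
  have hp' : 0 < p.toReal := ENNReal.toReal_pos hp0 hp
  have hpow : Tendsto (fun i => ∫⁻ x, ‖u i x‖ₑ ^ p.toReal ∂μ) l (𝓝 (∫⁻ _, 0 ∂μ)) := by
    refine tendsto_lintegral_filter_of_dominated_convergence' (fun _ => (M : ℝ≥0∞) ^ p.toReal)
      (.of_forall fun i => (hu i).enorm.pow_const _)
      (.of_forall fun i => ae_of_all _ fun x => ?_) ?_ ?_
    · exact ENNReal.rpow_le_rpow (ENNReal.coe_le_coe.2 (huM i x)) hp'.le
    · rw [lintegral_const]
      exact ENNReal.mul_ne_top (ENNReal.rpow_ne_top_of_nonneg hp'.le ENNReal.coe_ne_top)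
        (measure_ne_top _ _)
    · filter_upwards [hlim] with x hx
      simpa [ENNReal.zero_rpow_of_pos hp'] using hx.enorm.ennrpow_const p.toReal
  simp only [eLpNorm_eq_lintegral_rpow_enorm_toReal hp0 hp]
  simpa [ENNReal.zero_rpow_of_pos (inv_pos.2 hp')] using hpow.ennrpow_const (1 / p.toReal)

lemma tendsto_eLpNorm_comp_sub_comp_of_bounded [TopologicalSpace β] [OpensMeasurableSpace β]
    [SecondCountableTopologyEither β E] (hp0 : p ≠ 0) (hp : p ≠ ∞)
    {X : ι → α → β} {X' : α → β} (hX : ∀ i, AEMeasurable (X i) μ) (hX' : AEMeasurable X' μ)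
    (hlim : ∀ᵐ x ∂μ, Tendsto (fun i => X i x) l (𝓝 (X' x))) {g : β → E} (hg : Continuous g)
    {M : ℝ} (hM : ∀ y, ‖g y‖ ≤ M) :
    Tendsto (fun i => eLpNorm (g ∘ X i - g ∘ X') p μ) l (𝓝 0) := by
  refine tendsto_eLpNorm_zero_of_bounded hp0 hp (M := Real.toNNReal M + Real.toNNReal M)
    (fun i => (hg.aestronglyMeasurable.comp_aemeasurable (hX i)).sub
      (hg.aestronglyMeasurable.comp_aemeasurable hX')) (fun i x => ?_) ?_
  · exact (nnnorm_sub_le _ _).trans (add_le_add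
      (NNReal.le_toNNReal_of_coe_le (hM _)) (NNReal.le_toNNReal_of_coe_le (hM _)))
  · filter_upwards [hlim] with x hx
    simpa using ((hg.tendsto _).comp hx).sub_const (g (X' x))

variable [NormedSpace ℝ E] [TopologicalSpace β] [NormalSpace β] [R1Space β]
  [WeaklyLocallyCompactSpace β] [BorelSpace β] [SecondCountableTopologyEither β E] [ν.Regular]

-- For continuous compactly supported `f` this is dominated convergence; these are dense in `L^p`.
lemma tendsto_eLpNorm_comp_sub_comp (hp1 : 1 ≤ p) (hp : p ≠ ∞) (hc : c ≠ ∞) {X : ι → α → β}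
    {X' : α → β} (hX : ∀ i, AEMeasurable (X i) μ) (hX' : AEMeasurable X' μ)
    (hXc : ∀ i, μ.map (X i) ≤ c • ν) (hXc' : μ.map X' ≤ c • ν)
    (hlim : ∀ᵐ x ∂μ, Tendsto (fun i => X i x) l (𝓝 (X' x))) (hf : MemLp f p ν) :
    Tendsto (fun i => eLpNorm (f ∘ X i - f ∘ X') p μ) l (𝓝 0) := by
  refine ENNReal.tendsto_nhds_zero.2 fun ε hε => ?_
  have hε3 : ε / 3 ≠ 0 := (ENNReal.div_pos hε.ne' (by finiteness)).ne'
  obtain ⟨δ, hδ, hδε⟩ := ENNReal.exists_nnreal_pos_mul_lt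
    (ENNReal.rpow_ne_top_of_nonneg (y := (1 / p).toReal) ENNReal.toReal_nonneg hc) hε3
  obtain ⟨g, hgs, hfg, hgc, hg⟩ :=
    hf.exists_hasCompactSupport_eLpNorm_sub_le hp (ENNReal.coe_ne_zero.2 hδ.ne')
  obtain ⟨M, hM⟩ := hgs.exists_bound_of_continuous hgc
  have hfgY : ∀ {Y : α → β}, AEMeasurable Y μ → μ.map Y ≤ c • ν →
      AEStronglyMeasurable ((f - g) ∘ Y) μ ∧ eLpNorm ((f - g) ∘ Y) p μ ≤ ε / 3 :=
    fun hY hYc => ⟨aestronglyMeasurable_comp_of_map_le_smul hY hYc (hf.1.sub hg.1),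
      (eLpNorm_comp_le_of_map_le_smul hp hY hYc (hf.1.sub hg.1)).trans
        ((mul_le_mul_right hfg _).trans (by rw [mul_comm]; exact hδε.le))⟩
  have hgX : ∀ i, AEStronglyMeasurable (g ∘ X i - g ∘ X') μ := fun i =>
    (hgc.aestronglyMeasurable.comp_aemeasurable (hX i)).sub
      (hgc.aestronglyMeasurable.comp_aemeasurable hX')
  have hgl := tendsto_eLpNorm_comp_sub_comp_of_bounded (zero_lt_one.trans_le hp1).ne' hp hX hX'
    hlim hgc hM
  filter_upwards [(ENNReal.tendsto_nhds_zero.1 hgl) (ε / 3) (pos_iff_ne_zero.2 hε3)] with i hi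
  obtain ⟨hm, hle⟩ := hfgY (hX i) (hXc i)
  obtain ⟨hm', hle'⟩ := hfgY hX' hXc'
  calc eLpNorm (f ∘ X i - f ∘ X') p μ
      = eLpNorm ((f - g) ∘ X i + (g ∘ X i - g ∘ X') - (f - g) ∘ X') p μ := by
        congr 1
        funext x
        simp only [Pi.sub_apply, Pi.add_apply, Function.comp_apply]
        abel
    _ ≤ eLpNorm ((f - g) ∘ X i) p μ + eLpNorm (g ∘ X i - g ∘ X') p μ
        + eLpNorm ((f - g) ∘ X') p μ :=
        (eLpNorm_sub_le (hm.add (hgX i)) hm' hp1).trans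
          (by gcongr; exact eLpNorm_add_le hm (hgX i) hp1)
    _ ≤ ε / 3 + ε / 3 + ε / 3 := by gcongr
    _ = ε := ENNReal.add_thirds ε

end CompositionInLp

lemma Icc_subset_closure_of_ae {a b : ℝ} (hab : a < b) {P : ℝ → Prop}
    (hP : ∀ᵐ t ∂(volume.restrict (Ioo a b)), P t) : Icc a b ⊆ closure (Ioo a b ∩ {t | P t}) := by
  have hdense : Dense {t | t ∈ Ioo a b → P t} :=
    Measure.dense_of_ae ((ae_restrict_iff' measurableSet_Ioo).1 hP)
  rw [← closure_Ioo hab.ne]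
  refine closure_minimal ((hdense.open_subset_closure_inter isOpen_Ioo).trans ?_) isClosed_closure
  exact closure_mono fun t ht => ⟨ht.1, ht.2 ht.1⟩

lemma ContL2.ae_eq_comp {a b : ℝ} (hab : a < b) {A : Set ℝ} (hA : volume A ≠ ⊤)
    {y : ℝ → ℝ → ℝ} (hy : ContL2 (Icc a b) A y) {f : ℝ → ℝ} (hf : MemLp f 2)
    {X : ℝ → ℝ → ℝ} (hX : ∀ r, Measurable (X r)) (hXcont : ∀ s, Continuous fun r => X r s)
    {c : ENNReal} (hc : c ≠ ⊤)
    (hXc : ∀ r ∈ Icc a b, (volume.restrict A).map (X r) ≤ c • (volume : Measure ℝ))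
    (hae : ∀ᵐ r ∂(volume.restrict (Ioo a b)), y r =ᵐ[volume.restrict A] f ∘ X r)
    {r : ℝ} (hr : r ∈ Icc a b) : y r =ᵐ[volume.restrict A] f ∘ X r := by
  have : Fact (volume A < ⊤) := ⟨hA.lt_top⟩
  obtain ⟨ρ, hρ, hρr⟩ := mem_closure_iff_seq_limit.1 (Icc_subset_closure_of_ae hab hae hr)
  have hρI : ∀ n, ρ n ∈ Icc a b := fun n => Ioo_subset_Icc_self (hρ n).1
  have hmeas : ∀ r ∈ Icc a b, AEStronglyMeasurable (f ∘ X r) (volume.restrict A) := fun r hr =>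
    aestronglyMeasurable_comp_of_map_le_smul (hX r).aemeasurable (hXc r hr) hf.1
  have hfX : Tendsto (fun n => eLpNorm (f ∘ X (ρ n) - f ∘ X r) 2 (volume.restrict A))
      atTop (𝓝 0) :=
    tendsto_eLpNorm_comp_sub_comp one_le_two ENNReal.ofNat_ne_top hc
      (fun n => (hX (ρ n)).aemeasurable) (hX r).aemeasurable (fun n => hXc _ (hρI n)) (hXc r hr)
      (ae_of_all _ fun x => ((hXcont x).tendsto r).comp hρr) hf
  have hyr : Tendsto (fun n => eLpNorm (y (ρ n) - y r) 2 (volume.restrict A)) atTop (𝓝 0) :=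
    (hy.2 r hr).comp (tendsto_nhdsWithin_iff.2 ⟨hρr, .of_forall hρI⟩)
  have hle : ∀ n, eLpNorm (y r - f ∘ X r) 2 (volume.restrict A) ≤
      eLpNorm (f ∘ X (ρ n) - f ∘ X r) 2 (volume.restrict A)
        + eLpNorm (y (ρ n) - y r) 2 (volume.restrict A) := fun n => by
    have hsplit : y r - f ∘ X r =ᵐ[volume.restrict A]
        (f ∘ X (ρ n) - f ∘ X r) - (y (ρ n) - y r) := by
      filter_upwards [(hρ n).2] with x hx
      simp only [Pi.sub_apply, hx]
      ring
    rw [eLpNorm_congr_ae hsplit]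
    exact eLpNorm_sub_le ((hmeas _ (hρI n)).sub (hmeas r hr))
      ((hy.1 _ (hρI n)).1.sub (hy.1 r hr).1) one_le_two
  have hzero : eLpNorm (y r - f ∘ X r) 2 (volume.restrict A) = 0 :=
    le_antisymm (ge_of_tendsto' (by simpa using hfX.add hyr) hle) zero_le
  have h := (eLpNorm_eq_zero_iff ((hy.1 r hr).1.sub (hmeas r hr)) two_ne_zero).1 hzero
  exact h.mono fun x hx => sub_eq_zero.1 hx

namespace NegativeSpeed

variable {l : ℝ → ℝ → ℝ} {C K ε t0 : ℝ} {f : ℝ → ℝ}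

lemma map_flow_le (hl : NegativeSpeed l C K ε) {t t1 : ℝ} (ht : t ∈ Icc t0 t1) (A : Set ℝ) :
    (volume.restrict A).map (fun x => flow l t x t0) ≤
      ENNReal.ofReal (Real.exp (K * (t1 - t0))) • (volume : Measure ℝ) := by
  refine map_restrict_volume_le (X := fun x => flow l t x t0) (hl.continuous_flow.comp
    (f := fun x : ℝ => (t, x, t0)) (by fun_prop)).measurable (Real.exp_pos _).le ?_
  intro x _ x' _
  have hK := hl.K_nonneg
  have h := hl.abs_flow_sub_flow_le t x t x' t0 t
  rw [hl.flow_self, hl.flow_self, mul_comm, abs_of_nonneg (sub_nonneg.2 ht.1)] at h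
  refine h.trans ?_
  gcongr
  exact ht.2

lemma map_flow_initialTime_le (hl : NegativeSpeed l C K ε) {t1 : ℝ} (x : ℝ) {A : Set ℝ}
    (hA : A ⊆ Icc t0 t1) :
    (volume.restrict A).map (fun s => flow l s x t0) ≤
      ENNReal.ofReal (ε⁻¹ * Real.exp (K * (t1 - t0))) • (volume : Measure ℝ) := by
  have hε := hl.pos
  have hK := hl.K_nonneg
  refine map_restrict_volume_le (X := fun s => flow l s x t0) (hl.continuous_flow.comp
    (f := fun s : ℝ => (s, x, t0)) (by fun_prop)).measurable (by positivity) ?_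
  intro s hs s' _
  refine (hl.abs_sub_le_mul_flow_initialTime t0 x s s').trans ?_
  gcongr
  rw [abs_of_nonneg (sub_nonneg.2 (hA hs).1)]
  exact sub_le_sub_right (hA hs).2 t0

lemma ae_eq_of_ae_eq_comp_flow (hl : NegativeSpeed l C K ε) (hf : MemLp f 2)
    {y : ℝ → ℝ → ℝ} (hy : ∀ᵐ q : ℝ × ℝ ∂(volume.restrict (Ioi t0 ×ˢ Ioo 0 1)),
      y q.1 q.2 = f (flow l q.1 q.2 t0))
    (hcont : ∀ T > 0, ContL2 (Icc t0 (t0 + T)) (Ioo 0 1) y) {t : ℝ} (ht : t0 ≤ t) :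
    y t =ᵐ[volume.restrict (Ioo 0 1)] fun x => f (flow l t x t0) := by
  have hT : 0 < t - t0 + 1 := by linarith
  rw [Measure.volume_eq_prod, ← Measure.prod_restrict] at hy
  exact (hcont _ hT).ae_eq_comp (by linarith) (by simp) hf (X := fun r x => flow l r x t0)
    (fun r => (hl.continuous_flow.comp (f := fun x : ℝ => (r, x, t0)) (by fun_prop)).measurable)
    (fun x => hl.continuous_flow.comp (f := fun r : ℝ => (r, x, t0)) (by fun_prop))
    ENNReal.ofReal_ne_top (fun r hr => hl.map_flow_le hr _)
    (ae_restrict_of_ae_restrict_of_subset Ioo_subset_Ioi_self (Measure.ae_ae_of_ae_prod hy))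
    ⟨ht, by linarith⟩

lemma ae_trace_eq_of_ae_eq_comp_flow (hl : NegativeSpeed l C K ε) (hf : MemLp f 2)
    {y : ℝ → ℝ → ℝ} (hy : ∀ᵐ q : ℝ × ℝ ∂(volume.restrict (Ioi t0 ×ˢ Ioo 0 1)),
      y q.1 q.2 = f (flow l q.1 q.2 t0))
    (hcont : ∀ T > 0, ContL2 (Icc 0 1) (Ioo t0 (t0 + T)) (fun x t => y t x)) :
    ∀ᵐ s ∂(volume.restrict (Ioi t0)), y s 0 = f (flow l s 0 t0) := by
  have hU : Ioi t0 = ⋃ n : ℕ, Ioo t0 (t0 + (n + 1)) := by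
    ext s
    simp only [mem_Ioi, mem_iUnion, mem_Ioo]
    refine ⟨fun h => ?_, fun ⟨n, h⟩ => h.1⟩
    obtain ⟨n, hn⟩ := exists_nat_gt (s - t0)
    exact ⟨n, h, by linarith⟩
  rw [Measure.volume_eq_prod, ← Measure.prod_restrict] at hy
  have hy' := Measure.ae_ae_of_ae_prod (Measure.measurePreserving_swap.quasiMeasurePreserving.ae hy)
  rw [hU, ae_restrict_iUnion_iff]
  intro n
  exact (hcont _ (by positivity)).ae_eq_comp zero_lt_one (by simp) hf
    (X := fun x s => flow l s x t0)
    (fun x => (hl.continuous_flow.comp (f := fun s : ℝ => (s, x, t0)) (by fun_prop)).measurable)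
    (fun s => hl.continuous_flow.comp (f := fun x : ℝ => (s, x, t0)) (by fun_prop))
    ENNReal.ofReal_ne_top (fun x _ => hl.map_flow_initialTime_le x Ioo_subset_Icc_self)
    (hy'.mono fun x hx => ae_restrict_of_ae_restrict_of_subset Ioo_subset_Ioi_self hx)
    (left_mem_Icc.2 zero_le_one)

end NegativeSpeed

/-- The solution of `∂v/∂t + l ∂v/∂x = 0` on `x < 1`, `l < 0`, with value `f` at time `t0` and zero
inflow at `x = 1`: initial data are carried along the characteristics, and only those of `(0,1]`
are kept. -/
noncomputable def transport (l : ℝ → ℝ → ℝ) (t0 : ℝ) (f : ℝ → ℝ) (t x : ℝ) : ℝ :=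
  (Ioc 0 1).indicator f (flow l t x t0)

lemma memLp_indicator_Ioc {p : ENNReal} {f : ℝ → ℝ} {a b : ℝ}
    (hf : MemLp f p (volume.restrict (Ioo a b))) : MemLp ((Ioc a b).indicator f) p :=
  (memLp_indicator_iff_restrict measurableSet_Ioc).2
    (by rwa [← Measure.restrict_congr_set Ioo_ae_eq_Ioc])

namespace NegativeSpeed

variable {l : ℝ → ℝ → ℝ} {C K ε t0 : ℝ} {f : ℝ → ℝ}

lemma transport_initialTime (hl : NegativeSpeed l C K ε) (t0 : ℝ) (f : ℝ → ℝ) {x : ℝ}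
    (hx : x ∈ Ioc (0 : ℝ) 1) : transport l t0 f t0 x = f x := by
  rw [transport, hl.flow_self, indicator_of_mem hx]

lemma transport_flow (hl : NegativeSpeed l C K ε) (t0 : ℝ) (f : ℝ → ℝ) (t x s : ℝ) :
    transport l t0 f s (flow l t x s) = transport l t0 f t x := by
  rw [transport, hl.flow_flow, transport]

lemma transport_eq_zero (hl : NegativeSpeed l C K ε) (f : ℝ → ℝ) {t x : ℝ}
    (ht : t0 ≤ t) (hx : 1 < x) : transport l t0 f t x = 0 := by
  have hlt : 1 < flow l t x t0 := by
    have h := (hl.flow_strictAnti t x).antitone ht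
    rw [hl.flow_self] at h
    linarith
  exact indicator_of_notMem (fun h => hlt.not_ge h.2) f

lemma memLp_transport_zero (hl : NegativeSpeed l C K ε) {p : ENNReal} (hp : p ≠ ⊤) (t0 : ℝ)
    (hf : MemLp f p (volume.restrict (Ioo 0 1))) : MemLp (fun s => transport l t0 f s 0) p := by
  have hmem : MemLp (fun s => transport l t0 f s 0) p
      (volume.restrict (Icc t0 (hitTime l 0 t0 1))) :=
    memLp_comp_of_map_le_smul hp ENNReal.ofReal_ne_top
      (hl.continuous_flow.comp (f := fun s : ℝ => (s, (0 : ℝ), t0)) (by fun_prop)).aemeasurable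
      (hl.map_flow_initialTime_le 0 subset_rfl) (memLp_indicator_Ioc hf)
  have hmono := hl.flow_initialTime_strictMono t0 0
  have hsupp : (Icc t0 (hitTime l 0 t0 1)).indicator (fun s => transport l t0 f s 0) =
      fun s => transport l t0 f s 0 := by
    refine indicator_eq_self.2 fun s hs => ?_
    have hs' : flow l s 0 t0 ∈ Ioc (0 : ℝ) 1 := mem_of_indicator_ne_zero hs
    constructor
    · exact hmono.le_iff_le.1 (by simpa only [hl.flow_self] using hs'.1.le)
    · exact hmono.le_iff_le.1 (by simpa only [hl.flow_initialTime_hitTime] using hs'.2)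
  rwa [← memLp_indicator_iff_restrict measurableSet_Icc, hsupp] at hmem

lemma integrable_transport_zero (hl : NegativeSpeed l C K ε) (t0 : ℝ)
    (hf : IntegrableOn f (Ioo 0 1)) : Integrable fun s => transport l t0 f s 0 :=
  memLp_one_iff_integrable.1
    (hl.memLp_transport_zero ENNReal.one_ne_top t0 (memLp_one_iff_integrable.2 hf))

end NegativeSpeed

/-- The integral of `g u` along the characteristic of `l` through `(t,x)`, from `t` until it
reaches `0`. -/
noncomputable def outflowIntegral (l g : ℝ → ℝ → ℝ) (u : ℝ → ℝ) (t x : ℝ) : ℝ :=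
  ∫ s in t..hitTime l 0 t x, g s (flow l t x s) * u s

namespace NegativeSpeed

variable {l : ℝ → ℝ → ℝ} {C K ε : ℝ} {g : ℝ → ℝ → ℝ} {u : ℝ → ℝ} {M : ℝ}

lemma integrable_mul_flow (hl : NegativeSpeed l C K ε)
    (hg : Continuous fun q : ℝ × ℝ => g q.1 q.2) (hgM : ∀ s y, |g s y| ≤ M) (hu : Integrable u)
    (t x : ℝ) : Integrable fun s => g s (flow l t x s) * u s :=
  hu.bdd_mul (hg.comp (f := fun s : ℝ => (s, flow l t x s))
    (continuous_id.prodMk (hl.continuous_flow_time t x))).aestronglyMeasurable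
    (ae_of_all _ fun _ => hgM _ _)

lemma continuous_integral_mul_flow (hl : NegativeSpeed l C K ε)
    (hg : Continuous fun q : ℝ × ℝ => g q.1 q.2) (hgM : ∀ s y, |g s y| ≤ M) (hu : Integrable u) :
    Continuous fun q : (ℝ × ℝ) × ℝ => ∫ s in (0 : ℝ)..q.2, g s (flow l q.1.1 q.1.2 s) * u s := by
  refine continuous_iff_continuousAt.2 fun q => ?_
  refine intervalIntegral.continuousAt_parametric_primitive_of_dominated (fun s => M * |u s|)
    (min 0 q.2 - 1) (max 0 q.2 + 1)
    (fun q' : ℝ × ℝ => (hl.integrable_mul_flow hg hgM hu q'.1 q'.2).1.restrict)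
    (Eventually.of_forall fun q' => ae_of_all _ fun s => ?_)
    (hu.abs.const_mul M).intervalIntegrable (ae_of_all _ fun s => ?_) ?_ ?_ Real.volume_singleton
  · rw [norm_mul]
    exact mul_le_mul_of_nonneg_right (hgM _ _) (abs_nonneg _)
  · have hflow : Continuous fun q : ℝ × ℝ => flow l q.1 q.2 s :=
      hl.continuous_flow.comp (f := fun q : ℝ × ℝ => (q.1, q.2, s)) (by fun_prop)
    exact ((hg.comp (f := fun q : ℝ × ℝ => (s, flow l q.1 q.2 s))
      (continuous_const.prodMk hflow)).mul continuous_const).continuousAt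
  all_goals constructor <;> linarith [min_le_left 0 q.2, min_le_right 0 q.2, le_max_left 0 q.2,
    le_max_right 0 q.2]

lemma continuous_outflowIntegral (hl : NegativeSpeed l C K ε)
    (hg : Continuous fun q : ℝ × ℝ => g q.1 q.2) (hgM : ∀ s y, |g s y| ≤ M) (hu : Integrable u) :
    Continuous fun q : ℝ × ℝ => outflowIntegral l g u q.1 q.2 := by
  have hprim := hl.continuous_integral_mul_flow hg hgM hu
  refine ((hprim.comp (continuous_id.prodMk (hl.continuous_hitTime 0))).sub
    (hprim.comp (continuous_id.prodMk continuous_fst))).congr fun q => ?_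
  have hint := hl.integrable_mul_flow hg hgM hu q.1 q.2
  exact intervalIntegral.integral_interval_sub_left hint.intervalIntegrable hint.intervalIntegrable

lemma outflowIntegral_flow (hl : NegativeSpeed l C K ε)
    (hg : Continuous fun q : ℝ × ℝ => g q.1 q.2) (hgM : ∀ s y, |g s y| ≤ M) (hu : Integrable u)
    (t x r : ℝ) : outflowIntegral l g u r (flow l t x r)
      = (∫ s in r..t, g s (flow l t x s) * u s) + outflowIntegral l g u t x := by
  have hint := hl.integrable_mul_flow hg hgM hu t x
  simp only [outflowIntegral, hl.flow_flow, hl.hitTime_flow]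
  exact (intervalIntegral.integral_add_adjacent_intervals hint.intervalIntegrable
    hint.intervalIntegrable).symm

end NegativeSpeed

/-- The continuous extension to `ℝ²` of a function on `[0,+∞) × [0,1]` by projection onto the
strip. -/
def stripExtend (g : ℝ → ℝ → ℝ) (t x : ℝ) : ℝ := g (max 0 t) (max 0 (min 1 x))

lemma stripExtend_eq (g : ℝ → ℝ → ℝ) {t x : ℝ} (ht : 0 ≤ t) (hx : x ∈ Icc (0 : ℝ) 1) :
    stripExtend g t x = g t x := by
  rw [stripExtend, max_eq_right ht, min_eq_right hx.2, max_eq_right hx.1]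

lemma ContBddStrip.continuous_stripExtend {g : ℝ → ℝ → ℝ} (hg : ContBddStrip g) :
    Continuous fun q : ℝ × ℝ => stripExtend g q.1 q.2 :=
  hg.1.comp_continuous (f := fun q : ℝ × ℝ => (max 0 q.1, max 0 (min 1 q.2))) (by fun_prop)
    fun _ => ⟨mem_Ici.2 (le_max_left _ _), le_max_left _ _, max_le zero_le_one (min_le_left _ _)⟩

lemma ContBddStrip.exists_abs_stripExtend_le {g : ℝ → ℝ → ℝ} (hg : ContBddStrip g) :
    ∃ M, ∀ t x, |stripExtend g t x| ≤ M :=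
  hg.2.imp fun _ h _ _ => h _ (mem_Ici.2 (le_max_left _ _)) _
    ⟨le_max_left _ _, max_le zero_le_one (min_le_left _ _)⟩

namespace NegativeSpeed

variable {l : ℝ → ℝ → ℝ} {C K ε : ℝ}

lemma integral_Ioi_eq_integral_flow_initialTime (hl : NegativeSpeed l C K ε) (y t : ℝ)
    (φ : ℝ → ℝ) : ∫ ξ in Ioi y, φ ξ = ∫ s in Ioi t,
      |-(l s y) * Real.exp (∫ r in s..t, deriv (l r) (flow l s y r))| * φ (flow l s y t) := by
  rw [← hl.image_flow_initialTime_Ioi y t]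
  exact integral_image_eq_integral_abs_deriv_smul measurableSet_Ioi
    (fun s _ => (hl.hasDerivAt_flow_initialTime t y s).hasDerivWithinAt)
    (hl.flow_initialTime_strictMono t y).injective.injOn φ

lemma integrableOn_Ioi_iff_flow_initialTime (hl : NegativeSpeed l C K ε) (y t : ℝ)
    (φ : ℝ → ℝ) : IntegrableOn φ (Ioi y) ↔ IntegrableOn (fun s =>
      |-(l s y) * Real.exp (∫ r in s..t, deriv (l r) (flow l s y r))| * φ (flow l s y t))
      (Ioi t) := by
  rw [← hl.image_flow_initialTime_Ioi y t]
  exact integrableOn_image_iff_integrableOn_abs_deriv_smul measurableSet_Ioi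
    (fun s _ => (hl.hasDerivAt_flow_initialTime t y s).hasDerivWithinAt)
    (hl.flow_initialTime_strictMono t y).injective.injOn φ

end NegativeSpeed

/-- The solution of the kernel equation for the pair of speeds `li`, `lj`: the boundary value at
`ξ = 0` is carried back along the characteristics with the factor that keeps `h dξ` invariant. -/
noncomputable def explicitKernel (li lj g : ℝ → ℝ → ℝ) (t x ξ : ℝ) : ℝ :=
  if hitTime lj 0 t ξ < hitTime li 0 t x then
    -(g (hitTime lj 0 t ξ) (flow li t x (hitTime lj 0 t ξ)) / lj (hitTime lj 0 t ξ) 0)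
      * Real.exp (∫ r in t..hitTime lj 0 t ξ, deriv (lj r) (flow lj t ξ r))
  else 0

namespace NegativeSpeed

variable {li lj g : ℝ → ℝ → ℝ} {Ci Ki εi Cj Kj εj M t x : ℝ}

lemma abs_jacobian_mul_explicitKernel (hj : NegativeSpeed lj Cj Kj εj) (li g : ℝ → ℝ → ℝ)
    (t x : ℝ) (w : ℝ → ℝ) (s : ℝ) :
    |-(lj s 0) * Real.exp (∫ r in s..t, deriv (lj r) (flow lj s 0 r))|
        * (explicitKernel li lj g t x (flow lj s 0 t) * w (flow lj s 0 t))
      = (Iio (hitTime li 0 t x)).indicator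
          (fun s => g s (flow li t x s) * w (flow lj s 0 t)) s := by
  have hneg : lj s 0 < 0 := (hj.lt_neg s 0).trans (neg_lt_zero.2 hj.pos)
  have hspeed := hneg.ne
  rw [abs_of_pos (mul_pos (neg_pos.2 hneg) (Real.exp_pos _)), explicitKernel,
    hj.hitTime_initialTime]
  simp only [hj.flow_flow]
  by_cases hs : s < hitTime li 0 t x
  · rw [if_pos hs, indicator_of_mem (mem_Iio.2 hs), intervalIntegral.integral_symm t s,
      Real.exp_neg]
    field_simp
  · rw [if_neg hs, indicator_of_notMem (notMem_Iio.2 (not_lt.1 hs)), zero_mul, mul_zero]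

lemma setIntegral_explicitKernel_mul (hi : NegativeSpeed li Ci Ki εi)
    (hj : NegativeSpeed lj Cj Kj εj) (g : ℝ → ℝ → ℝ) (t : ℝ) (hx : 0 ≤ x) (w : ℝ → ℝ) :
    ∫ ξ in Ioi 0, explicitKernel li lj g t x ξ * w ξ
      = outflowIntegral li g (fun s => w (flow lj s 0 t)) t x := by
  have ht : t ≤ hitTime li 0 t x := (hi.le_hitTime_iff 0 t x t).2 (by rwa [hi.flow_self])
  simp only [hj.integral_Ioi_eq_integral_flow_initialTime 0 t,
    hj.abs_jacobian_mul_explicitKernel]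
  rw [setIntegral_indicator measurableSet_Iio, Ioi_inter_Iio, outflowIntegral,
    intervalIntegral.integral_of_le ht, integral_Ioc_eq_integral_Ioo]

lemma integrableOn_explicitKernel_mul (hj : NegativeSpeed lj Cj Kj εj) {w : ℝ → ℝ}
    (hw : Integrable fun s => g s (flow li t x s) * w (flow lj s 0 t)) :
    IntegrableOn (fun ξ => explicitKernel li lj g t x ξ * w ξ) (Ioi 0) := by
  simp only [hj.integrableOn_Ioi_iff_flow_initialTime 0 t,
    hj.abs_jacobian_mul_explicitKernel]
  exact (hw.indicator measurableSet_Iio).integrableOn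

lemma measurable_explicitKernel (hi : NegativeSpeed li Ci Ki εi) (hj : NegativeSpeed lj Cj Kj εj)
    (hg : Continuous fun q : ℝ × ℝ => g q.1 q.2) (t : ℝ) :
    Measurable fun q : ℝ × ℝ => explicitKernel li lj g t q.1 q.2 := by
  have hτi : Continuous fun q : ℝ × ℝ => hitTime li 0 t q.1 :=
    (hi.continuous_hitTime 0).comp (f := fun q : ℝ × ℝ => (t, q.1)) (by fun_prop)
  have hτj : Continuous fun q : ℝ × ℝ => hitTime lj 0 t q.2 :=
    (hj.continuous_hitTime 0).comp (f := fun q : ℝ × ℝ => (t, q.2)) (by fun_prop)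
  have hflow : Continuous fun q : (ℝ × ℝ) × ℝ => flow lj t q.1.2 q.2 :=
    hj.continuous_flow.comp (f := fun q : (ℝ × ℝ) × ℝ => (t, q.1.2, q.2)) (by fun_prop)
  have hexit : Continuous fun q : ℝ × ℝ => flow li t q.1 (hitTime lj 0 t q.2) :=
    hi.continuous_flow.comp (f := fun q : ℝ × ℝ => (t, q.1, hitTime lj 0 t q.2)) (by fun_prop)
  have hspeed : Continuous fun q : ℝ × ℝ => lj (hitTime lj 0 t q.2) 0 :=
    hj.continuous.comp (f := fun q : ℝ × ℝ => (hitTime lj 0 t q.2, (0 : ℝ))) (by fun_prop)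
  have hjac := intervalIntegral.continuous_parametric_intervalIntegral_of_continuous (μ := volume)
    (f := fun (q : ℝ × ℝ) r => deriv (lj r) (flow lj t q.2 r)) (a₀ := t)
    (hj.continuous_deriv.comp (continuous_snd.prodMk hflow)) hτj
  exact Measurable.ite (isOpen_lt hτj hτi).measurableSet
    (((hg.comp (hτj.prodMk hexit)).measurable.div hspeed.measurable).neg.mul
      (Real.continuous_exp.comp hjac).measurable) measurable_const

lemma abs_hitTime_zero_sub_le (hj : NegativeSpeed lj Cj Kj εj) (t : ℝ) {ξ : ℝ}
    (hξ : ξ ∈ Icc (0 : ℝ) 1) : |hitTime lj 0 t ξ - t| ≤ εj⁻¹ := by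
  have h := hj.mul_abs_sub_le t ξ (hitTime lj 0 t ξ) t
  rw [hj.flow_hitTime, hj.flow_self, zero_sub, abs_neg, abs_of_nonneg hξ.1] at h
  rw [inv_eq_one_div, le_div_iff₀ hj.pos, mul_comm]
  exact h.trans hξ.2

lemma abs_explicitKernel_le (hj : NegativeSpeed lj Cj Kj εj) (hgM : ∀ s y, |g s y| ≤ M)
    (t x : ℝ) {ξ : ℝ} (hξ : ξ ∈ Icc (0 : ℝ) 1) :
    |explicitKernel li lj g t x ξ| ≤ M / εj * Real.exp (Kj * εj⁻¹) := by
  have hε := hj.pos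
  have hK := hj.K_nonneg
  have hM : 0 ≤ M := (abs_nonneg _).trans (hgM 0 0)
  have hspeed : εj ≤ |lj (hitTime lj 0 t ξ) 0| :=
    le_trans (by linarith [hj.lt_neg (hitTime lj 0 t ξ) 0]) (neg_le_abs _)
  have hjac : |∫ r in t..hitTime lj 0 t ξ, deriv (lj r) (flow lj t ξ r)| ≤ Kj * εj⁻¹ :=
    (intervalIntegral.norm_integral_le_of_norm_le_const
      (f := fun r => deriv (lj r) (flow lj t ξ r)) fun r _ => hj.deriv_bound r _).trans
      (mul_le_mul_of_nonneg_left (hj.abs_hitTime_zero_sub_le t hξ) hK)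
  rw [explicitKernel]
  split_ifs
  · rw [abs_mul, abs_neg, abs_div, Real.abs_exp]
    gcongr
    · exact hgM _ _
    · exact (le_abs_self _).trans hjac
  · rw [abs_zero]
    positivity

lemma exists_pos_flow_mem_Ioo (hi : NegativeSpeed li Ci Ki εi) (hj : NegativeSpeed lj Cj Kj εj)
    {ξ : ℝ} (ht : 0 ≤ t) (hx : x ∈ Icc (0 : ℝ) 1) (htx : 0 < t ∨ 0 < x)
    (hξ : ξ ∈ Ioo (0 : ℝ) 1) :
    ∃ s > 0, flow li t x s ∈ Ioo (0 : ℝ) 1 ∧ flow lj t ξ s ∈ Ioo (0 : ℝ) 1 := by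
  have hi_near : Tendsto (flow li t x) (𝓝 t) (𝓝 x) := by
    simpa only [hi.flow_self] using (hi.continuous_flow_time t x).tendsto t
  have hj_near : ∀ᶠ s in 𝓝 t, flow lj t ξ s ∈ Ioo (0 : ℝ) 1 :=
    (hj.continuous_flow_time t ξ).continuousAt.eventually_mem
      (by simpa only [hj.flow_self] using Ioo_mem_nhds hξ.1 hξ.2)
  have hanti := hi.flow_strictAnti t x
  rcases hx.1.eq_or_lt with rfl | hx0
  · have ht0 : 0 < t := htx.resolve_right (lt_irrefl _)
    obtain ⟨s, ⟨hs0, hs1, hsj⟩, hst⟩ := (((lt_mem_nhds ht0).and ((hi_near.eventually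
      (gt_mem_nhds zero_lt_one)).and hj_near)).filter_mono nhdsWithin_le_nhds).and
      (self_mem_nhdsWithin (s := Iio t)) |>.exists
    exact ⟨s, hs0, ⟨by simpa only [hi.flow_self] using hanti hst, hs1⟩, hsj⟩
  · obtain ⟨s, ⟨hs0, hsj⟩, hst⟩ := (((hi_near.eventually (lt_mem_nhds hx0)).and
      hj_near).filter_mono nhdsWithin_le_nhds).and (self_mem_nhdsWithin (s := Ioi t)) |>.exists
    have hsx : flow li t x s < x := by simpa only [hi.flow_self] using hanti hst
    exact ⟨s, ht.trans_lt hst, ⟨hs0, hsx.trans_le hx.2⟩, hsj⟩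

end NegativeSpeed

lemma eq_mul_exp_integral_of_hasDerivWithinAt {η a : ℝ → ℝ} (ha : Continuous a) {e o : ℝ}
    (hη : ∀ s ∈ Icc e o, HasDerivWithinAt η (-a s * η s) (Icc e o) s) {t : ℝ}
    (ht : t ∈ Icc e o) : η t = η o * Real.exp (∫ r in t..o, a r) := by
  set E := fun s => η s * Real.exp (∫ r in t..s, a r) with hE
  have hE' : ∀ s ∈ Icc e o, HasDerivWithinAt E 0 (Icc e o) s := fun s hs =>
    ((hη s hs).fun_mul
      ((ha.integral_hasStrictDerivAt t s).hasDerivAt.exp.hasDerivWithinAt)).congr_deriv (by ring)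
  have hconst := constant_of_derivWithin_zero (fun s hs => (hE' s hs).differentiableWithinAt)
    fun s hs => (hE' s (Ico_subset_Icc_self hs)).derivWithin
      (uniqueDiffOn_Icc (hs.1.trans_lt hs.2) s (Ico_subset_Icc_self hs))
  have hto : E t = E o := (hconst t ht).trans (hconst o (right_mem_Icc.2 (ht.1.trans ht.2))).symm
  simpa [hE] using hto

namespace IsKernelSolution

variable {m p : ℕ} {Λ : StateIdx m p → ℝ → ℝ → ℝ} {g : ℝ → ℝ → Matrix (Fin m) (Fin m) ℝ}
  {h : ℝ → ℝ → ℝ → Matrix (Fin m) (Fin m) ℝ} {C K ε : ℝ} {i j : Fin m} {t x ξ : ℝ}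

lemma eq_kernelExitValue_mul_exp (hh : IsKernelSolution Λ g h)
    (hi : NegativeSpeed (Λ (Sum.inl i)) C K ε) (hj : NegativeSpeed (Λ (Sum.inl j)) C K ε)
    (ht : 0 ≤ t) (hx : x ∈ Icc (0 : ℝ) 1) (hξ : ξ ∈ Icc (0 : ℝ) 1) {t' : ℝ} (ht' : 0 < t')
    (hx' : flow (Λ (Sum.inl i)) t x t' ∈ Ioo (0 : ℝ) 1)
    (hξ' : flow (Λ (Sum.inl j)) t ξ t' ∈ Ioo (0 : ℝ) 1)
    (hne : exitTime Λ (Sum.inl i) t x ≠ exitTime Λ (Sum.inl j) t ξ) :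
    h t x ξ i j = kernelExitValue Λ g i j t x ξ * Real.exp (∫ r in t..exitTime₂ Λ i j t x ξ,
      deriv (Λ (Sum.inl j) r) (flow (Λ (Sum.inl j)) t ξ r)) := by
  have hode := hh.ode i j t' ht' _ hx' _ hξ'
  have hval := hh.exit_value i j t' ht' _ hx' _ hξ'
  have hexit_i : exitTime Λ (Sum.inl i) t' (flow (Λ (Sum.inl i)) t x t') =
    exitTime Λ (Sum.inl i) t x := hi.hitTime_flow 0 t x t'
  have hexit_j : exitTime Λ (Sum.inl j) t' (flow (Λ (Sum.inl j)) t ξ t') =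
    exitTime Λ (Sum.inl j) t ξ := hj.hitTime_flow 0 t ξ t'
  have hentry_i : entryTime Λ (Sum.inl i) t' (flow (Λ (Sum.inl i)) t x t') =
    entryTime Λ (Sum.inl i) t x := hi.hitTime_flow 1 t x t'
  have hentry_j : entryTime Λ (Sum.inl j) t' (flow (Λ (Sum.inl j)) t ξ t') =
    entryTime Λ (Sum.inl j) t ξ := hj.hitTime_flow 1 t ξ t'
  simp only [kernelExitValue, entryTime₂, exitTime₂, hexit_i, hexit_j, hentry_i, hentry_j, chi,
    hi.flow_flow, hj.flow_flow] at hode hval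
  have hmem_i := (hi.flow_mem_Icc_iff 0 1 t x t).1 (by rwa [hi.flow_self])
  have hmem_j := (hj.flow_mem_Icc_iff 0 1 t ξ t).1 (by rwa [hj.flow_self])
  have hsol := eq_mul_exp_integral_of_hasDerivWithinAt (hj.continuous_deriv.comp
    (continuous_id.prodMk (hj.continuous_flow_time t ξ))) (hode hne) (t := t)
    ⟨max_le ht (max_le hmem_i.1 hmem_j.1), le_min hmem_i.2 hmem_j.2⟩
  rw [hi.flow_self, hj.flow_self, hval hne] at hsol
  exact hsol

lemma eq_explicitKernel (hh : IsKernelSolution Λ g h)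
    (hi : NegativeSpeed (Λ (Sum.inl i)) C K ε) (hj : NegativeSpeed (Λ (Sum.inl j)) C K ε)
    (ht : 0 ≤ t) (hx : x ∈ Icc (0 : ℝ) 1) (htx : 0 < t ∨ 0 < x) (hξ : ξ ∈ Ioo (0 : ℝ) 1)
    (hne : exitTime Λ (Sum.inl i) t x ≠ exitTime Λ (Sum.inl j) t ξ) :
    h t x ξ i j = explicitKernel (Λ (Sum.inl i)) (Λ (Sum.inl j))
      (stripExtend fun t x => g t x i j) t x ξ := by
  obtain ⟨t', ht', hx', hξ'⟩ := hi.exists_pos_flow_mem_Ioo hj ht hx htx hξ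
  rw [hh.eq_kernelExitValue_mul_exp hi hj ht hx (Ioo_subset_Icc_self hξ) ht' hx' hξ' hne,
    kernelExitValue, exitTime₂]
  change _ = if exitTime Λ (Sum.inl j) t ξ < exitTime Λ (Sum.inl i) t x then _ else _
  rcases lt_or_gt_of_ne hne with hlt | hlt
  · rw [if_pos hlt, if_neg hlt.not_gt, zero_mul]
  · have htj : t ≤ exitTime Λ (Sum.inl j) t ξ :=
      (hj.le_hitTime_iff 0 t ξ t).2 (by rw [hj.flow_self]; exact hξ.1.le)
    have hti : entryTime Λ (Sum.inl i) t x ≤ t :=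
      (hi.hitTime_le_iff 1 t x t).2 (by rw [hi.flow_self]; exact hx.2)
    have hmem := (hi.flow_mem_Icc_iff 0 1 t x _).2 ⟨hti.trans htj, hlt.le⟩
    rw [if_neg hlt.not_gt, if_pos hlt, min_eq_right hlt.le]
    exact congrArg (fun a => -(a / _) * _)
      (stripExtend_eq (fun t x => g t x i j) (ht.trans htj) hmem).symm

lemma ae_eq_explicitKernel (hh : IsKernelSolution Λ g h)
    (hi : NegativeSpeed (Λ (Sum.inl i)) C K ε) (hj : NegativeSpeed (Λ (Sum.inl j)) C K ε)
    (ht : 0 ≤ t) (hx : x ∈ Icc (0 : ℝ) 1) (htx : 0 < t ∨ 0 < x) :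
    ∀ᵐ ξ ∂(volume.restrict (Ioo 0 1)), h t x ξ i j = explicitKernel (Λ (Sum.inl i))
      (Λ (Sum.inl j)) (stripExtend fun t x => g t x i j) t x ξ := by
  have hne := hj.ae_hitTime 0 t (Measure.ae_ne volume (exitTime Λ (Sum.inl i) t x))
  filter_upwards [ae_restrict_of_ae hne, ae_restrict_mem measurableSet_Ioo] with ξ hne hξ
  exact hh.eq_explicitKernel hi hj ht hx htx hξ hne.symm

lemma integral_mul_eq_outflowIntegral (hh : IsKernelSolution Λ g h)
    (hi : NegativeSpeed (Λ (Sum.inl i)) C K ε) (hj : NegativeSpeed (Λ (Sum.inl j)) C K ε)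
    (hg : ContBddStrip fun t x => g t x i j) {t0 : ℝ} (ht0 : 0 ≤ t0) (ht : t0 ≤ t)
    (hx : x ∈ Icc (0 : ℝ) 1) (htx : 0 < t ∨ 0 < x) {f v : ℝ → ℝ}
    (hf : IntegrableOn f (Ioo 0 1))
    (hv : v =ᵐ[volume.restrict (Ioo 0 1)] transport (Λ (Sum.inl j)) t0 f t) :
    IntegrableOn (fun ξ => h t x ξ i j * v ξ) (Ioo 0 1) ∧
    ∫ ξ in (0 : ℝ)..1, h t x ξ i j * v ξ
      = outflowIntegral (Λ (Sum.inl i)) (stripExtend fun t x => g t x i j)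
          (fun s => transport (Λ (Sum.inl j)) t0 f s 0) t x := by
  set k := explicitKernel (Λ (Sum.inl i)) (Λ (Sum.inl j)) (stripExtend fun t x => g t x i j) t x
    with hk
  set w := transport (Λ (Sum.inl j)) t0 f t with hw
  have htrace : ∀ s, w (flow (Λ (Sum.inl j)) s 0 t) = transport (Λ (Sum.inl j)) t0 f s 0 :=
    fun s => hj.transport_flow t0 f s 0 t
  have hhk : (fun ξ => h t x ξ i j * v ξ) =ᵐ[volume.restrict (Ioo 0 1)] fun ξ => k ξ * w ξ := by
    filter_upwards [hh.ae_eq_explicitKernel hi hj (ht0.trans ht) hx htx, hv] with ξ hξ hvξ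
    rw [hξ, hvξ]
  have hvanish : ∀ ξ ∈ Ioi (0 : ℝ) \ Ioc 0 1, k ξ * w ξ = 0 := fun ξ hξ => by
    rw [hw, hj.transport_eq_zero f ht (not_le.1 fun h => hξ.2 ⟨hξ.1, h⟩), mul_zero]
  obtain ⟨M, hM⟩ := hg.exists_abs_stripExtend_le
  constructor
  · refine IntegrableOn.congr_fun_ae ?_ hhk.symm
    refine (hj.integrableOn_explicitKernel_mul ?_).mono_set Ioo_subset_Ioi_self
    simp only [htrace]
    exact hi.integrable_mul_flow hg.continuous_stripExtend hM
      (hj.integrable_transport_zero t0 hf) t x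
  · calc ∫ ξ in (0 : ℝ)..1, h t x ξ i j * v ξ = ∫ ξ in Ioo 0 1, k ξ * w ξ := by
          rw [intervalIntegral.integral_of_le zero_le_one, integral_Ioc_eq_integral_Ioo,
            integral_congr_ae hhk]
      _ = ∫ ξ in Ioi 0, k ξ * w ξ := by
          rw [← integral_Ioc_eq_integral_Ioo, setIntegral_eq_of_subset_of_forall_sdiff_eq_zero
            measurableSet_Ioi Ioc_subset_Ioi_self hvanish]
      _ = _ := by simp only [hk, hi.setIntegral_explicitKernel_mul hj _ t hx.1, htrace]

lemma memLp_top_slice (hh : IsKernelSolution Λ g h)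
    (hi : NegativeSpeed (Λ (Sum.inl i)) C K ε) (hj : NegativeSpeed (Λ (Sum.inl j)) C K ε)
    (hg : ContBddStrip fun t x => g t x i j) (ht : 0 ≤ t) :
    MemLp (fun q : ℝ × ℝ => h t q.1 q.2 i j) ⊤
      ((volume.restrict (Ioo 0 1)).prod (volume.restrict (Ioo 0 1))) := by
  obtain ⟨M, hM⟩ := hg.exists_abs_stripExtend_le
  have hτi : Continuous fun q : ℝ × ℝ => hitTime (Λ (Sum.inl i)) 0 t q.1 :=
    (hi.continuous_hitTime 0).comp (f := fun q : ℝ × ℝ => (t, q.1)) (by fun_prop)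
  have hτj : Continuous fun q : ℝ × ℝ => hitTime (Λ (Sum.inl j)) 0 t q.2 :=
    (hj.continuous_hitTime 0).comp (f := fun q : ℝ × ℝ => (t, q.2)) (by fun_prop)
  have hne : ∀ᵐ q : ℝ × ℝ ∂((volume.restrict (Ioo 0 1)).prod (volume.restrict (Ioo 0 1))),
      exitTime Λ (Sum.inl i) t q.1 ≠ exitTime Λ (Sum.inl j) t q.2 :=
    (Measure.ae_prod_iff_ae_ae (isOpen_ne_fun hτi hτj).measurableSet).2
      (Eventually.of_forall fun x => ae_restrict_of_ae
        ((hj.ae_hitTime 0 t (Measure.ae_ne volume _)).mono fun _ h => h.symm))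
  have hmem : ∀ᵐ q : ℝ × ℝ ∂((volume.restrict (Ioo 0 1)).prod (volume.restrict (Ioo 0 1))),
      q ∈ Ioo (0 : ℝ) 1 ×ˢ Ioo (0 : ℝ) 1 := by
    rw [Measure.prod_restrict]
    exact ae_restrict_mem (measurableSet_Ioo.prod measurableSet_Ioo)
  have hk : MemLp (fun q : ℝ × ℝ => explicitKernel (Λ (Sum.inl i)) (Λ (Sum.inl j))
      (stripExtend fun t x => g t x i j) t q.1 q.2) ⊤
      ((volume.restrict (Ioo 0 1)).prod (volume.restrict (Ioo 0 1))) :=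
    memLp_top_of_bound (hi.measurable_explicitKernel hj
      hg.continuous_stripExtend t).aestronglyMeasurable _ (hmem.mono fun q hq =>
        hj.abs_explicitKernel_le hM t q.1 (Ioo_subset_Icc_self hq.2))
  refine hk.ae_eq ?_
  filter_upwards [hne, hmem] with q hq hq'
  exact (hh.eq_explicitKernel hi hj ht (Ioo_subset_Icc_self hq'.1) (Or.inr hq'.1.1) hq'.2 hq).symm

end IsKernelSolution

lemma ae_memLp_top_prodMk_left {α β : Type*} [MeasurableSpace α] [MeasurableSpace β]
    {μ : Measure α} {ν : Measure β} [SFinite ν] {f : α × β → ℝ}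
    (hf : MemLp f ⊤ (μ.prod ν)) : ∀ᵐ x ∂μ, MemLp (fun y => f (x, y)) ⊤ ν := by
  have hbound := ae_le_eLpNormEssSup (f := f) (μ := μ.prod ν)
  filter_upwards [hf.1.prodMk_left, Measure.ae_ae_of_ae_prod hbound] with x hmeas hx
  refine ⟨hmeas, ?_⟩
  rw [eLpNorm_exponent_top]
  exact (essSup_le_of_ae_le _ hx).trans_lt (eLpNorm_exponent_top (f := f) ▸ hf.2)

lemma sum_integral_mul_sub_mulVec {α ι : Type*} [MeasurableSpace α] [Fintype ι]
    {μ : Measure α} [IsFiniteMeasure μ] {φ v : α → ι → ℝ} {K : α → α → Matrix ι ι ℝ}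
    (hφ : ∀ i, MemLp (fun x => φ x i) ⊤ μ)
    (hK : ∀ i j, MemLp (fun q : α × α => K q.1 q.2 i j) ⊤ (μ.prod μ))
    (hv : ∀ j, Integrable (fun y => v y j) μ) :
    ∑ i, ∫ x, φ x i * (v x i - ∫ y, (K x y).mulVec (v y) i ∂μ) ∂μ
      = ∑ j, ∫ y, (φ y j - ∫ x, (K x y).vecMul (φ x) j ∂μ) * v y j ∂μ := by
  have hφKv : ∀ i j, Integrable (fun q : α × α => φ q.1 i * (K q.1 q.2 i j * v q.2 j))
      (μ.prod μ) := fun i j =>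
    (((hv j).comp_snd μ).mul_of_top_right (hK i j)).mul_of_top_right
      ((hφ i).comp_fst μ)
  have hrow : ∀ i, Integrable (fun q : α × α => φ q.1 i * (K q.1 q.2).mulVec (v q.2) i)
      (μ.prod μ) := fun i => by
    simp only [Matrix.mulVec, dotProduct, Finset.mul_sum]
    exact integrable_finsetSum _ fun j _ => hφKv i j
  have hcol : ∀ j, Integrable (fun q : α × α => (K q.1 q.2).vecMul (φ q.1) j * v q.2 j)
      (μ.prod μ) := fun j => by
    simp only [Matrix.vecMul, dotProduct, Finset.sum_mul, mul_assoc]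
    exact integrable_finsetSum _ fun i _ => hφKv i j
  have hφv : ∀ i, Integrable (fun x => φ x i * v x i) μ := fun i =>
    (hv i).mul_of_top_right (hφ i)
  have hduality : ∑ i, ∫ x, φ x i * ∫ y, (K x y).mulVec (v y) i ∂μ ∂μ
      = ∑ j, ∫ y, (∫ x, (K x y).vecMul (φ x) j ∂μ) * v y j ∂μ := by
    simp only [← integral_const_mul, ← integral_mul_const]
    simp only [← integral_prod _ (hrow _), ← integral_prod_symm _ (hcol _)]
    rw [← integral_finsetSum _ fun i _ => hrow i, ← integral_finsetSum _ fun j _ => hcol j]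
    exact integral_congr_ae (ae_of_all _ fun q => Matrix.dotProduct_mulVec _ _ _)
  have hrow' : ∀ i, Integrable (fun x => φ x i * ∫ y, (K x y).mulVec (v y) i ∂μ) μ := fun i => by
    simpa only [integral_const_mul] using (hrow i).integral_prod_left
  have hcol' : ∀ j, Integrable (fun y => (∫ x, (K x y).vecMul (φ x) j ∂μ) * v y j) μ := fun j => by
    simpa only [integral_mul_const] using (hcol j).integral_prod_right
  simp only [mul_sub, sub_mul, integral_sub (hφv _) (hrow' _), integral_sub (hφv _) (hcol' _),
    Finset.sum_sub_distrib, hduality]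

lemma intervalIntegral_zero_one_eq (f : ℝ → ℝ) :
    ∫ ξ in (0 : ℝ)..1, f ξ = ∫ ξ in Ioo (0 : ℝ) 1, f ξ := by
  rw [intervalIntegral.integral_of_le zero_le_one, integral_Ioc_eq_integral_Ioo]

section FredholmSlice

variable {m p : ℕ}

lemma IsGainSolution.ae_sum_integral_mul_fredholmSlice
    {H : ℝ → ℝ → ℝ → Matrix (StateIdx m p) (StateIdx m p) ℝ}
    {F : ℝ → ℝ → Matrix (Fin m) (StateIdx m p) ℝ} (hF : IsGainSolution H F)
    (hH : ∀ t > 0, ∀ i j, MemLp (fun q : ℝ × ℝ => H t q.1 q.2 i j) ⊤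
      ((volume.restrict (Ioo 0 1)).prod (volume.restrict (Ioo 0 1)))) :
    ∀ᵐ t ∂(volume.restrict (Ioi 0)), ∀ (k : Fin m) (v : ℝ → StateIdx m p → ℝ),
      (∀ j, IntegrableOn (fun ξ => v ξ j) (Ioo 0 1)) →
      ∑ j, ∫ ξ in (0 : ℝ)..1, F t ξ k j * fredholmSlice (H t) v ξ j
        = -∑ j, ∫ ξ in (0 : ℝ)..1, H t 1 ξ (Sum.inl k) j * v ξ j := by
  have hbounded := hF.bounded
  have hequation := hF.equation
  simp only [EssBddStrip, Measure.volume_eq_prod, ← Measure.prod_restrict] at hbounded hequation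
  have hslice : ∀ᵐ t ∂(volume.restrict (Ioi (0 : ℝ))), ∀ k j,
      MemLp (fun ξ => F t ξ k j) ⊤ (volume.restrict (Ioo 0 1)) :=
    ae_all_iff.2 fun k => ae_all_iff.2 fun j => ae_memLp_top_prodMk_left (hbounded k j)
  filter_upwards [hslice, Measure.ae_ae_of_ae_prod hequation, ae_restrict_mem measurableSet_Ioi]
    with t hFt hequation ht k v hv
  simp only [fredholmSlice, intervalIntegral_zero_one_eq] at hequation ⊢
  rw [sum_integral_mul_sub_mulVec (hFt k) (hH t ht) hv, ← Finset.sum_neg_distrib]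
  refine Finset.sum_congr rfl fun j _ => ?_
  rw [← integral_neg]
  refine integral_congr_ae (hequation.mono fun ξ hξ => ?_)
  exact (congrArg (· * v ξ j) (hξ k j)).trans (neg_mul _ _)

variable (h : ℝ → ℝ → ℝ → Matrix (Fin m) (Fin m) ℝ)

lemma fullKernel_mulVec_inl (t x ξ : ℝ) (v : StateIdx m p → ℝ) (i : Fin m) :
    (fullKernel h t x ξ).mulVec v (Sum.inl i) = ∑ j, h t x ξ i j * v (Sum.inl j) := by
  simp [fullKernel, Matrix.mulVec, dotProduct]

lemma fredholmSlice_fullKernel_inr (t : ℝ) (v : ℝ → StateIdx m p → ℝ) (x : ℝ) (k : Fin p) :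
    fredholmSlice (fullKernel h t) v x (Sum.inr k) = v x (Sum.inr k) := by
  simp [fredholmSlice, fullKernel, Matrix.mulVec, dotProduct]

variable {h}

lemma fredholmSlice_fullKernel_inl {t x : ℝ} {v : ℝ → StateIdx m p → ℝ} {i : Fin m}
    (hint : ∀ j, IntegrableOn (fun ξ => h t x ξ i j * v ξ (Sum.inl j)) (Ioo 0 1)) :
    fredholmSlice (fullKernel h t) v x (Sum.inl i)
      = v x (Sum.inl i) - ∑ j, ∫ ξ in (0 : ℝ)..1, h t x ξ i j * v ξ (Sum.inl j) := by
  simp only [fredholmSlice, fullKernel_mulVec_inl]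
  rw [intervalIntegral.integral_finsetSum]
  exact fun j _ => (intervalIntegrable_iff_integrableOn_Ioo_of_le zero_le_one).2 (hint j)

lemma memLp_top_fullKernel {t : ℝ} {μ : Measure (ℝ × ℝ)}
    (hmem : ∀ i j, MemLp (fun q : ℝ × ℝ => h t q.1 q.2 i j) ⊤ μ) (i j : StateIdx m p) :
    MemLp (fun q : ℝ × ℝ => fullKernel h t q.1 q.2 i j) ⊤ μ :=
  match i, j with
  | Sum.inl i, Sum.inl j => hmem i j
  | Sum.inl _, Sum.inr _ => MemLp.zero
  | Sum.inr _, Sum.inl _ => MemLp.zero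
  | Sum.inr _, Sum.inr _ => MemLp.zero

end FredholmSlice

section

variable {S A : Set ℝ} {f g : ℝ → ℝ → ℝ}

lemma ContL2.sub (hf : ContL2 S A f) (hg : ContL2 S A g) :
    ContL2 S A fun t x => f t x - g t x := by
  refine ⟨fun t ht => (hf.1 t ht).sub (hg.1 t ht), fun t ht => ?_⟩
  have hlim := (hf.2 t ht).add (hg.2 t ht)
  rw [add_zero] at hlim
  refine tendsto_of_tendsto_of_tendsto_of_le_of_le' tendsto_const_nhds hlim
    (.of_forall fun _ => zero_le) ?_
  filter_upwards [self_mem_nhdsWithin] with s hs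
  have hdiff : (fun x => f s x - g s x - (f t x - g t x))
      = (fun x => f s x - f t x) - fun x => g s x - g t x :=
    funext fun _ => sub_sub_sub_comm _ _ _ _
  rw [hdiff]
  exact eLpNorm_sub_le ((hf.1 s hs).sub (hf.1 t ht)).1 ((hg.1 s hs).sub (hg.1 t ht)).1 one_le_two

lemma ContL2.congr (hf : ContL2 S A f) (h : ∀ t ∈ S, f t =ᵐ[volume.restrict A] g t) :
    ContL2 S A g := by
  refine ⟨fun t ht => (hf.1 t ht).ae_eq (h t ht), fun t ht => (hf.2 t ht).congr' ?_⟩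
  filter_upwards [self_mem_nhdsWithin] with s hs
  exact eLpNorm_congr_ae ((h s hs).sub (h t ht))

lemma memLp_restrict_Ioo_of_continuous {w : ℝ → ℝ} (hw : Continuous w) (p : ENNReal) (a b : ℝ) :
    MemLp w p (volume.restrict (Ioo a b)) := by
  obtain ⟨M, hM⟩ := isCompact_Icc.exists_bound_of_continuousOn (hw.continuousOn (s := Icc a b))
  refine MemLp.of_bound hw.aestronglyMeasurable M ?_
  filter_upwards [ae_restrict_mem measurableSet_Ioo] with x hx
  exact hM x (Ioo_subset_Icc_self hx)

lemma contL2_of_continuous {w : ℝ → ℝ → ℝ} (hw : Continuous fun q : ℝ × ℝ => w q.1 q.2)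
    (S : Set ℝ) (a b : ℝ) : ContL2 S (Ioo a b) w := by
  refine ⟨fun t _ => memLp_restrict_Ioo_of_continuous
    (hw.comp (f := fun x : ℝ => (t, x)) (by fun_prop)) 2 a b, fun t _ => ?_⟩
  set W : C(ℝ, C(Icc a b, ℝ)) := ContinuousMap.curry ⟨fun q : ℝ × Icc a b => w q.1 q.2,
    hw.comp (f := fun q : ℝ × Icc a b => (q.1, (q.2 : ℝ))) (by fun_prop)⟩
  set c := (volume.restrict (Ioo a b) univ) ^ ((2 : ENNReal).toReal)⁻¹
  have hc : c ≠ ⊤ := ENNReal.rpow_ne_top_of_nonneg (by norm_num) (by simp)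
  have hdist : Tendsto (fun s => c * ENNReal.ofReal (dist (W s) (W t))) (𝓝[S] t) (𝓝 0) := by
    have hW : Tendsto (fun s => dist (W s) (W t)) (𝓝[S] t) (𝓝 0) :=
      tendsto_iff_dist_tendsto_zero.1 (W.continuous.continuousWithinAt)
    simpa using ENNReal.Tendsto.const_mul (ENNReal.tendsto_ofReal hW) (Or.inr hc)
  refine tendsto_of_tendsto_of_tendsto_of_le_of_le tendsto_const_nhds hdist
    (fun _ => zero_le) fun s => eLpNorm_le_of_ae_bound ?_
  filter_upwards [ae_restrict_mem measurableSet_Ioo] with x hx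
  exact ContinuousMap.dist_apply_le_dist (f := W s) (g := W t) ⟨x, Ioo_subset_Icc_self hx⟩

end

lemma NegativeSpeed.ae_prod_hitTime {l : ℝ → ℝ → ℝ} {C K ε : ℝ} (hl : NegativeSpeed l C K ε)
    (y : ℝ) {P : ℝ → Prop} (hP : ∀ᵐ s, P s) : ∀ᵐ q : ℝ × ℝ, P (hitTime l y q.1 q.2) := by
  obtain ⟨N, hPN, hN, hN0⟩ := exists_measurable_superset_of_null hP
  have hmeas : MeasurableSet {q : ℝ × ℝ | hitTime l y q.1 q.2 ∉ N} :=
    (hl.continuous_hitTime y).measurable hN.compl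
  have hae : ∀ᵐ q : ℝ × ℝ, hitTime l y q.1 q.2 ∉ N :=
    (Measure.ae_prod_iff_ae_ae hmeas).2
      (ae_of_all _ fun t => hl.ae_hitTime y t (measure_eq_zero_iff_ae_notMem.1 hN0))
  exact hae.mono fun q hq => by_contra fun h => hq (hPN h)

/-- The part of the standing assumptions that does not order the speeds within each family, with
named constants: the first `m` speeds are less than `-ε` and the last `p` are greater than `ε`. -/
structure SignedSpeeds {m p : ℕ} (Λ : StateIdx m p → ℝ → ℝ → ℝ) (C K ε : ℝ) : Prop where
  regular : ∀ i, RegularSpeed (Λ i) C K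
  pos : 0 < ε
  lt_neg : ∀ (i : Fin m) (t x : ℝ), Λ (Sum.inl i) t x < -ε
  lt : ∀ (i : Fin p) (t x : ℝ), ε < Λ (Sum.inr i) t x

section BoundaryCoupling

variable {m p : ℕ} {Λ : StateIdx m p → ℝ → ℝ → ℝ} {C K ε : ℝ}

lemma AdmissibleSpeeds.exists_signedSpeeds (hΛ : AdmissibleSpeeds Λ) :
    ∃ C K ε, SignedSpeeds Λ C K ε := by
  obtain ⟨C, hC⟩ := hΛ.bounded
  obtain ⟨K, hK⟩ := hΛ.bounded_deriv
  obtain ⟨ε, hε, hsign⟩ := hΛ.speeds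
  exact ⟨C, K, ε, fun i => ⟨hΛ.contDiff i, hC i, hK i⟩, hε, fun i t x => (hsign t x).1 i,
    fun i t x => (hsign t x).2.1 i⟩

lemma SignedSpeeds.negativeSpeed (hΛ : SignedSpeeds Λ C K ε) (i : Fin m) :
    NegativeSpeed (Λ (Sum.inl i)) C K ε :=
  ⟨hΛ.regular _, hΛ.pos, hΛ.lt_neg i⟩

lemma entryTime_inl (i : Fin m) (t x : ℝ) :
    entryTime Λ (Sum.inl i) t x = hitTime (Λ (Sum.inl i)) 1 t x := rfl

/-- The contribution `∫₀¹ h(t,x,ξ) z₋(t,ξ) dξ` of the kernel with boundary values `g` to the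
`i`-th component of the transformation, written in terms of the initial data `z0`: by the change
of variables from `ξ` to the time at which `χⱼ(·;t,ξ)` reaches `0`, it is an integral of `g z₋(·,0)`
along `χᵢ(·;t,x)`. -/
noncomputable def outflowTerm (Λ : StateIdx m p → ℝ → ℝ → ℝ)
    (g : ℝ → ℝ → Matrix (Fin m) (Fin m) ℝ) (t0 : ℝ) (z0 : ℝ → StateIdx m p → ℝ) (i : Fin m)
    (t x : ℝ) : ℝ :=
  ∑ j, outflowIntegral (Λ (Sum.inl i)) (stripExtend fun t x => g t x i j)
    (fun s => transport (Λ (Sum.inl j)) t0 (fun y => z0 y (Sum.inl j)) s 0) t x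

variable {g : ℝ → ℝ → Matrix (Fin m) (Fin m) ℝ} {h : ℝ → ℝ → ℝ → Matrix (Fin m) (Fin m) ℝ}
  {t0 t x : ℝ} {z0 v : ℝ → StateIdx m p → ℝ}

lemma continuous_outflowTerm (hl : ∀ i : Fin m, NegativeSpeed (Λ (Sum.inl i)) C K ε)
    (hg : ∀ i j, ContBddStrip fun t x => g t x i j) (t0 : ℝ)
    (hz0 : ∀ j : Fin m, IntegrableOn (fun y => z0 y (Sum.inl j)) (Ioo 0 1)) (i : Fin m) :
    Continuous fun q : ℝ × ℝ => outflowTerm Λ g t0 z0 i q.1 q.2 := by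
  refine continuous_finsetSum _ fun j _ => ?_
  obtain ⟨M, hM⟩ := (hg i j).exists_abs_stripExtend_le
  exact (hl i).continuous_outflowIntegral (hg i j).continuous_stripExtend hM
    ((hl j).integrable_transport_zero t0 (hz0 j))

lemma outflowTerm_flow (hl : ∀ i : Fin m, NegativeSpeed (Λ (Sum.inl i)) C K ε)
    (hg : ∀ i j, ContBddStrip fun t x => g t x i j)
    (hz0 : ∀ j : Fin m, IntegrableOn (fun y => z0 y (Sum.inl j)) (Ioo 0 1)) (i : Fin m)
    (t x r : ℝ) :
    outflowTerm Λ g t0 z0 i r (flow (Λ (Sum.inl i)) t x r)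
      = (∑ j, ∫ s in r..t, stripExtend (fun t x => g t x i j) s (flow (Λ (Sum.inl i)) t x s)
          * transport (Λ (Sum.inl j)) t0 (fun y => z0 y (Sum.inl j)) s 0)
        + outflowTerm Λ g t0 z0 i t x := by
  simp only [outflowTerm, ← Finset.sum_add_distrib]
  refine Finset.sum_congr rfl fun j _ => ?_
  obtain ⟨M, hM⟩ := (hg i j).exists_abs_stripExtend_le
  exact (hl i).outflowIntegral_flow (hg i j).continuous_stripExtend hM
    ((hl j).integrable_transport_zero t0 (hz0 j)) t x r

lemma outflowTerm_zero (hl : ∀ i : Fin m, NegativeSpeed (Λ (Sum.inl i)) C K ε) (i : Fin m) :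
    outflowTerm Λ g t0 z0 i t 0 = 0 := by
  simp only [outflowTerm, outflowIntegral, (hl i).hitTime_self, intervalIntegral.integral_same,
    Finset.sum_const_zero]

namespace IsKernelSolution

lemma sum_integral_mul_eq_outflowTerm (hh : IsKernelSolution Λ g h)
    (hl : ∀ i : Fin m, NegativeSpeed (Λ (Sum.inl i)) C K ε)
    (hg : ∀ i j, ContBddStrip fun t x => g t x i j) (ht0 : 0 ≤ t0)
    (hz0 : ∀ j : Fin m, IntegrableOn (fun y => z0 y (Sum.inl j)) (Ioo 0 1))
    (ht : t0 ≤ t) (hx : x ∈ Icc (0 : ℝ) 1) (htx : 0 < t ∨ 0 < x)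
    (hv : ∀ j : Fin m, (fun ξ => v ξ (Sum.inl j)) =ᵐ[volume.restrict (Ioo 0 1)]
      transport (Λ (Sum.inl j)) t0 (fun y => z0 y (Sum.inl j)) t) (i : Fin m) :
    ∑ j, ∫ ξ in (0 : ℝ)..1, h t x ξ i j * v ξ (Sum.inl j) = outflowTerm Λ g t0 z0 i t x :=
  Finset.sum_congr rfl fun j _ =>
    (hh.integral_mul_eq_outflowIntegral (hl i) (hl j) (hg i j) ht0 ht hx htx (hz0 j) (hv j)).2

lemma fredholmSlice_inl_eq (hh : IsKernelSolution Λ g h)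
    (hl : ∀ i : Fin m, NegativeSpeed (Λ (Sum.inl i)) C K ε)
    (hg : ∀ i j, ContBddStrip fun t x => g t x i j) (ht0 : 0 ≤ t0)
    (hz0 : ∀ j : Fin m, IntegrableOn (fun y => z0 y (Sum.inl j)) (Ioo 0 1))
    (ht : t0 ≤ t) (hx : x ∈ Icc (0 : ℝ) 1) (htx : 0 < t ∨ 0 < x)
    (hv : ∀ j : Fin m, (fun ξ => v ξ (Sum.inl j)) =ᵐ[volume.restrict (Ioo 0 1)]
      transport (Λ (Sum.inl j)) t0 (fun y => z0 y (Sum.inl j)) t) (i : Fin m) :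
    fredholmSlice (fullKernel h t) v x (Sum.inl i)
      = v x (Sum.inl i) - outflowTerm Λ g t0 z0 i t x := by
  rw [← hh.sum_integral_mul_eq_outflowTerm hl hg ht0 hz0 ht hx htx hv]
  exact fredholmSlice_fullKernel_inl fun j => (hh.integral_mul_eq_outflowIntegral (hl i) (hl j)
    (hg i j) ht0 ht hx htx (hz0 j) (hv j)).1

lemma fredholmSlice_initialTime_inl_eq (hh : IsKernelSolution Λ g h)
    (hl : ∀ i : Fin m, NegativeSpeed (Λ (Sum.inl i)) C K ε)
    (hg : ∀ i j, ContBddStrip fun t x => g t x i j) (ht0 : 0 ≤ t0)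
    (hz0 : ∀ j : Fin m, IntegrableOn (fun y => z0 y (Sum.inl j)) (Ioo 0 1))
    (hx : x ∈ Ioc (0 : ℝ) 1) (i : Fin m) :
    fredholmSlice (fullKernel h t0) z0 x (Sum.inl i)
      = z0 x (Sum.inl i) - outflowTerm Λ g t0 z0 i t0 x := by
  refine hh.fredholmSlice_inl_eq hl hg ht0 hz0 le_rfl (Ioc_subset_Icc_self hx) (Or.inr hx.1)
    (fun j => ?_) i
  filter_upwards [ae_restrict_mem measurableSet_Ioo] with ξ hξ
  exact ((hl j).transport_initialTime t0 (fun y => z0 y (Sum.inl j))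
    (Ioo_subset_Ioc_self hξ)).symm

lemma memLp_fredholmSlice_initialTime (hh : IsKernelSolution Λ g h)
    (hl : ∀ i : Fin m, NegativeSpeed (Λ (Sum.inl i)) C K ε)
    (hg : ∀ i j, ContBddStrip fun t x => g t x i j) (ht0 : 0 ≤ t0)
    {q : ENNReal} (hq : 1 ≤ q) (hz0 : ∀ i, MemLp (fun x => z0 x i) q (volume.restrict (Ioo 0 1)))
    (i : StateIdx m p) :
    MemLp (fun x => fredholmSlice (fullKernel h t0) z0 x i) q (volume.restrict (Ioo 0 1)) := by
  rcases i with i | k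
  · have hz0' := fun j : Fin m => (hz0 (Sum.inl j)).integrable hq
    refine MemLp.ae_eq ?_ ((hz0 (Sum.inl i)).sub (memLp_restrict_Ioo_of_continuous
      ((continuous_outflowTerm hl hg t0 hz0' i).comp (f := fun x : ℝ => (t0, x)) (by fun_prop))
      q 0 1))
    filter_upwards [ae_restrict_mem measurableSet_Ioo] with x hx
    exact (hh.fredholmSlice_initialTime_inl_eq hl hg ht0 hz0' (Ioo_subset_Ioc_self hx) i).symm
  · simpa only [fredholmSlice_fullKernel_inr] using hz0 (Sum.inr k)

lemma ae_sum_integral_gain_mul_fredholmSlice (hh : IsKernelSolution Λ g h)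
    (hl : ∀ i : Fin m, NegativeSpeed (Λ (Sum.inl i)) C K ε)
    (hg : ∀ i j, ContBddStrip fun t x => g t x i j)
    {F : ℝ → ℝ → Matrix (Fin m) (StateIdx m p) ℝ} (hF : IsGainSolution (fullKernel h) F) :
    ∀ᵐ t ∂(volume.restrict (Ioi 0)), ∀ (i : Fin m) (v : ℝ → StateIdx m p → ℝ),
      (∀ j, IntegrableOn (fun ξ => v ξ j) (Ioo 0 1)) →
      ∑ j, ∫ ξ in (0 : ℝ)..1, F t ξ i j * fredholmSlice (fullKernel h t) v ξ j
        = -∑ j, ∫ ξ in (0 : ℝ)..1, h t 1 ξ i j * v ξ (Sum.inl j) := by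
  have hH : ∀ t > 0, ∀ i j : StateIdx m p,
      MemLp (fun q : ℝ × ℝ => fullKernel h t q.1 q.2 i j) ⊤
        ((volume.restrict (Ioo 0 1)).prod (volume.restrict (Ioo 0 1))) := fun t ht =>
    memLp_top_fullKernel fun i j => hh.memLp_top_slice (hl i) (hl j) (hg i j) (le_of_lt ht)
  filter_upwards [hF.ae_sum_integral_mul_fredholmSlice hH] with t hgain i v hv
  rw [hgain i v hv, Fintype.sum_sum_type]
  simp [fullKernel]

end IsKernelSolution

namespace IsBroadSolution

variable {Q : ℝ → Matrix (Fin p) (Fin m) ℝ} {Gpm : ℝ → ℝ → Matrix (Fin p) (Fin m) ℝ}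
  {F : ℝ → ℝ → Matrix (Fin m) (StateIdx m p) ℝ} {z : ℝ → ℝ → StateIdx m p → ℝ}

lemma integrableOn_initial {M G : ℝ → ℝ → Matrix (StateIdx m p) (StateIdx m p) ℝ}
    (hz : IsBroadSolution Λ M G F Q t0 z0 z) (i : StateIdx m p) :
    IntegrableOn (fun x => z0 x i) (Ioo 0 1) :=
  (hz.initial_memLp i).integrable one_le_two

lemma ae_eq_transport (hz : IsBroadSolution Λ 0 (targetMatrix Gpm) 0 Q t0 z0 z) {j : Fin m}
    (hj : NegativeSpeed (Λ (Sum.inl j)) C K ε) :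
    ∀ᵐ q : ℝ × ℝ ∂(volume.restrict (Ioi t0 ×ˢ Ioo 0 1)), z q.1 q.2 (Sum.inl j)
      = transport (Λ (Sum.inl j)) t0 (fun y => z0 y (Sum.inl j)) q.1 q.2 := by
  filter_upwards [hz.equation (Sum.inl j),
    ae_restrict_mem (measurableSet_Ioi.prod measurableSet_Ioo)] with q hq hmem
  obtain ⟨ht, hx⟩ : t0 < q.1 ∧ q.2 ∈ Ioo (0 : ℝ) 1 := hmem
  rw [hq]
  simp only [targetMatrix, Fintype.sum_sum_type, Matrix.fromBlocks_apply₁₁,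
    Matrix.fromBlocks_apply₁₂, Pi.zero_apply, Matrix.zero_apply, zero_mul,
    intervalIntegral.integral_zero, Finset.sum_const_zero, add_zero, inflowValue, entryTime_inl]
  split_ifs with hentry <;> rw [hj.lt_hitTime_iff] at hentry
  · exact (indicator_of_notMem (fun h' => hentry.not_ge h'.2) _).symm
  · have hpos : 0 < flow (Λ (Sum.inl j)) q.1 q.2 t0 := by
      have hanti := hj.flow_strictAnti q.1 q.2 ht
      rw [hj.flow_self] at hanti
      exact hx.1.trans hanti
    exact (indicator_of_mem (show _ ∈ Ioc (0 : ℝ) 1 from ⟨hpos, not_lt.1 hentry⟩)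
      fun y => z0 y (Sum.inl j)).symm

lemma slice_ae_eq_transport (hz : IsBroadSolution Λ 0 (targetMatrix Gpm) 0 Q t0 z0 z) {j : Fin m}
    (hj : NegativeSpeed (Λ (Sum.inl j)) C K ε) (ht : t0 ≤ t) :
    (fun x => z t x (Sum.inl j)) =ᵐ[volume.restrict (Ioo 0 1)]
      transport (Λ (Sum.inl j)) t0 (fun y => z0 y (Sum.inl j)) t :=
  hj.ae_eq_of_ae_eq_comp_flow (y := fun t x => z t x (Sum.inl j))
    (memLp_indicator_Ioc (hz.initial_memLp (Sum.inl j))) (hz.ae_eq_transport hj)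
    (hz.regularity.cont_time (Sum.inl j)) ht

lemma trace_ae_eq_transport (hz : IsBroadSolution Λ 0 (targetMatrix Gpm) 0 Q t0 z0 z) {j : Fin m}
    (hj : NegativeSpeed (Λ (Sum.inl j)) C K ε) :
    ∀ᵐ s ∂(volume.restrict (Ioi t0)), z s 0 (Sum.inl j)
      = transport (Λ (Sum.inl j)) t0 (fun y => z0 y (Sum.inl j)) s 0 :=
  hj.ae_trace_eq_of_ae_eq_comp_flow (y := fun t x => z t x (Sum.inl j))
    (memLp_indicator_Ioc (hz.initial_memLp (Sum.inl j))) (hz.ae_eq_transport hj)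
    (hz.regularity.cont_space (Sum.inl j))

lemma fredholmTransform_inl_eq (hz : IsBroadSolution Λ 0 (targetMatrix Gpm) 0 Q t0 z0 z)
    (hh : IsKernelSolution Λ g h) (hl : ∀ i : Fin m, NegativeSpeed (Λ (Sum.inl i)) C K ε)
    (hg : ∀ i j, ContBddStrip fun t x => g t x i j) (ht0 : 0 ≤ t0)
    (ht : t0 ≤ t) (hx : x ∈ Icc (0 : ℝ) 1) (htx : 0 < t ∨ 0 < x) (i : Fin m) :
    fredholmTransform (fullKernel h) z t x (Sum.inl i)
      = z t x (Sum.inl i) - outflowTerm Λ g t0 z0 i t x :=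
  hh.fredholmSlice_inl_eq hl hg ht0 (fun j => hz.integrableOn_initial (Sum.inl j)) ht hx htx
    (fun j => hz.slice_ae_eq_transport (hl j) ht) i

lemma fredholmTransform_zero (hz : IsBroadSolution Λ 0 (targetMatrix Gpm) 0 Q t0 z0 z)
    (hh : IsKernelSolution Λ g h) (hl : ∀ i : Fin m, NegativeSpeed (Λ (Sum.inl i)) C K ε)
    (hg : ∀ i j, ContBddStrip fun t x => g t x i j) (ht0 : 0 ≤ t0) (ht : t0 < t) :
    fredholmTransform (fullKernel h) z t 0 = z t 0 := by
  funext i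
  rcases i with i | k
  · rw [hz.fredholmTransform_inl_eq hh hl hg ht0 ht.le (left_mem_Icc.2 zero_le_one)
      (Or.inl (ht0.trans_lt ht)), outflowTerm_zero hl, sub_zero]
  · exact fredholmSlice_fullKernel_inr h t (z t) 0 k

lemma broadRegularity_fredholmTransform (hz : IsBroadSolution Λ 0 (targetMatrix Gpm) 0 Q t0 z0 z)
    (hh : IsKernelSolution Λ g h) (hl : ∀ i : Fin m, NegativeSpeed (Λ (Sum.inl i)) C K ε)
    (hg : ∀ i j, ContBddStrip fun t x => g t x i j) (ht0 : 0 ≤ t0) :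
    BroadRegularity t0 (fredholmTransform (fullKernel h) z) := by
  have hγ := fun {t x} => hz.fredholmTransform_inl_eq hh hl hg ht0 (t := t) (x := x)
  have hW := continuous_outflowTerm hl hg t0 fun j => hz.integrableOn_initial (Sum.inl j)
  have hinr : ∀ t x k, fredholmTransform (fullKernel h) z t x (Sum.inr k) = z t x (Sum.inr k) :=
    fun t x k => fredholmSlice_fullKernel_inr h t (z t) x k
  constructor
  · rintro (i | k)
    · refine ((hz.regularity.measurable (Sum.inl i)).sub (hW i).aestronglyMeasurable).congr ?_
      filter_upwards [ae_restrict_mem (measurableSet_Ioi.prod measurableSet_Ioo)] with q hq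
      exact (hγ (le_of_lt hq.1) (Ioo_subset_Icc_self hq.2) (Or.inr hq.2.1) i).symm
    · simpa only [hinr] using hz.regularity.measurable (Sum.inr k)
  · rintro (i | k) T hT
    · refine ((hz.regularity.cont_time (Sum.inl i) T hT).sub
        (contL2_of_continuous (hW i) _ 0 1)).congr fun t ht => ?_
      filter_upwards [ae_restrict_mem measurableSet_Ioo] with x hx
      exact (hγ ht.1 (Ioo_subset_Icc_self hx) (Or.inr hx.1) i).symm
    · simpa only [hinr] using hz.regularity.cont_time (Sum.inr k) T hT
  · rintro (i | k) T hT
    · refine ((hz.regularity.cont_space (Sum.inl i) T hT).sub (contL2_of_continuous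
        (w := fun x t => outflowTerm Λ g t0 z0 i t x) ((hW i).comp continuous_swap)
        _ t0 (t0 + T))).congr fun x hx => ?_
      filter_upwards [ae_restrict_mem measurableSet_Ioo] with t ht
      exact (hγ ht.1.le hx (Or.inl (ht0.trans_lt ht.1)) i).symm
    · simpa only [hinr] using hz.regularity.cont_space (Sum.inr k) T hT

lemma sum_integral_sourceMatrix_eq (hz : IsBroadSolution Λ 0 (targetMatrix Gpm) 0 Q t0 z0 z)
    (hh : IsKernelSolution Λ g h) (hl : ∀ i : Fin m, NegativeSpeed (Λ (Sum.inl i)) C K ε)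
    (hg : ∀ i j, ContBddStrip fun t x => g t x i j) (ht0 : 0 ≤ t0) (i : Fin m) {r : ℝ}
    (hr : r ∈ Icc t0 t) (hmem : ∀ s ∈ Icc r t, chi Λ (Sum.inl i) s t x ∈ Icc (0 : ℝ) 1) :
    ∑ j, ∫ s in r..t, sourceMatrix g Gpm s (chi Λ (Sum.inl i) s t x) (Sum.inl i) j
        * fredholmTransform (fullKernel h) z s 0 j
      = outflowTerm Λ g t0 z0 i r (chi Λ (Sum.inl i) r t x) - outflowTerm Λ g t0 z0 i t x := by
  have htrace : ∀ᵐ s : ℝ, ∀ j : Fin m, t0 < s → z s 0 (Sum.inl j)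
      = transport (Λ (Sum.inl j)) t0 (fun y => z0 y (Sum.inl j)) s 0 :=
    ae_all_iff.2 fun j => (ae_restrict_iff' measurableSet_Ioi).1 (hz.trace_ae_eq_transport (hl j))
  rw [chi, outflowTerm_flow hl hg fun j => hz.integrableOn_initial (Sum.inl j),
    add_sub_cancel_right]
  simp only [sourceMatrix, Fintype.sum_sum_type, Matrix.fromBlocks_apply₁₁,
    Matrix.fromBlocks_apply₁₂, Matrix.zero_apply, zero_mul, intervalIntegral.integral_zero,
    Finset.sum_const_zero, add_zero]
  refine Finset.sum_congr rfl fun j _ => intervalIntegral.integral_congr_ae ?_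
  filter_upwards [htrace] with s hs hsmem
  rw [uIoc_of_le hr.2] at hsmem
  have hts : t0 < s := hr.1.trans_lt hsmem.1
  have hstrip : stripExtend (fun t x => g t x i j) s (flow (Λ (Sum.inl i)) t x s)
      = g s (chi Λ (Sum.inl i) s t x) i j :=
    stripExtend_eq _ (ht0.trans hts.le) (hmem s (Ioc_subset_Icc_self hsmem))
  rw [hz.fredholmTransform_zero hh hl hg ht0 hts, hs j hts, hstrip]

lemma ae_gain_eq_neg_outflowTerm (hz : IsBroadSolution Λ 0 (targetMatrix Gpm) 0 Q t0 z0 z)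
    (hh : IsKernelSolution Λ g h) (hl : ∀ i : Fin m, NegativeSpeed (Λ (Sum.inl i)) C K ε)
    (hg : ∀ i j, ContBddStrip fun t x => g t x i j) (hF : IsGainSolution (fullKernel h) F)
    (ht0 : 0 ≤ t0) :
    ∀ᵐ t, t0 < t → ∀ i : Fin m,
      ∑ j, ∫ ξ in (0 : ℝ)..1, F t ξ i j * fredholmTransform (fullKernel h) z t ξ j
        = -outflowTerm Λ g t0 z0 i t 1 := by
  filter_upwards [(ae_restrict_iff' measurableSet_Ioi).1
    (hh.ae_sum_integral_gain_mul_fredholmSlice hl hg hF)] with t hgain ht i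
  rw [← hh.sum_integral_mul_eq_outflowTerm hl hg ht0
    (fun j => hz.integrableOn_initial (Sum.inl j)) ht.le (right_mem_Icc.2 zero_le_one)
    (Or.inr one_pos) fun j => hz.slice_ae_eq_transport (hl j) ht.le]
  refine hgain (ht0.trans_lt ht) i (z t) fun j => ?_
  exact ((hz.regularity.cont_time j (t - t0) (sub_pos.2 ht)).1 t
    ⟨ht.le, by linarith⟩).integrable one_le_two

lemma ae_inflowValue_inl_eq (hz : IsBroadSolution Λ 0 (targetMatrix Gpm) 0 Q t0 z0 z)
    (hh : IsKernelSolution Λ g h) (hl : ∀ i : Fin m, NegativeSpeed (Λ (Sum.inl i)) C K ε)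
    (hg : ∀ i j, ContBddStrip fun t x => g t x i j) (hF : IsGainSolution (fullKernel h) F)
    (ht0 : 0 ≤ t0) (i : Fin m) :
    ∀ᵐ q : ℝ × ℝ ∂(volume.restrict (Ioi t0 ×ˢ Ioo 0 1)),
      inflowValue Λ F Q t0 (fredholmSlice (fullKernel h t0) z0)
          (fredholmTransform (fullKernel h) z) (Sum.inl i) q.1 q.2
        = z q.1 q.2 (Sum.inl i) - outflowTerm Λ g t0 z0 i (entryTimeFrom Λ t0 (Sum.inl i) q.1 q.2)
            (chi Λ (Sum.inl i) (entryTimeFrom Λ t0 (Sum.inl i) q.1 q.2) q.1 q.2) := by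
  filter_upwards [hz.ae_eq_transport (hl i),
    ae_restrict_mem (measurableSet_Ioi.prod measurableSet_Ioo),
    ae_restrict_of_ae ((hl i).ae_prod_hitTime 1 (hz.ae_gain_eq_neg_outflowTerm hh hl hg hF ht0))]
    with q hq hmem hgain
  obtain ⟨ht, hx⟩ : t0 < q.1 ∧ q.2 ∈ Ioo (0 : ℝ) 1 := hmem
  rw [hq, inflowValue, entryTimeFrom, entryTime_inl, chi, chi]
  by_cases hentry : t0 < hitTime (Λ (Sum.inl i)) 1 q.1 q.2
  · have hout : ¬flow (Λ (Sum.inl i)) q.1 q.2 t0 ∈ Ioc (0 : ℝ) 1 := fun hy =>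
      hy.2.not_gt (((hl i).lt_hitTime_iff 1 q.1 q.2 t0).1 hentry)
    rw [if_pos hentry, max_eq_right hentry.le, (hl i).flow_hitTime, transport,
      indicator_of_notMem hout, zero_sub]
    exact hgain hentry i
  · have hy : flow (Λ (Sum.inl i)) q.1 q.2 t0 ∈ Ioc (0 : ℝ) 1 := by
      have hanti := (hl i).flow_strictAnti q.1 q.2 ht
      rw [(hl i).flow_self] at hanti
      exact ⟨hx.1.trans hanti, not_lt.1 fun h' =>
        hentry (((hl i).lt_hitTime_iff 1 q.1 q.2 t0).2 h')⟩
    rw [if_neg hentry, max_eq_left (not_lt.1 hentry), transport, indicator_of_mem hy]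
    exact hh.fredholmSlice_initialTime_inl_eq hl hg ht0
      (fun j => hz.integrableOn_initial (Sum.inl j)) hy i

lemma ae_equation_inl (hz : IsBroadSolution Λ 0 (targetMatrix Gpm) 0 Q t0 z0 z)
    (hh : IsKernelSolution Λ g h) (hl : ∀ i : Fin m, NegativeSpeed (Λ (Sum.inl i)) C K ε)
    (hg : ∀ i j, ContBddStrip fun t x => g t x i j) (hF : IsGainSolution (fullKernel h) F)
    (ht0 : 0 ≤ t0) (i : Fin m) :
    ∀ᵐ q : ℝ × ℝ ∂(volume.restrict (Ioi t0 ×ˢ Ioo 0 1)),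
      fredholmTransform (fullKernel h) z q.1 q.2 (Sum.inl i)
        = inflowValue Λ F Q t0 (fredholmSlice (fullKernel h t0) z0)
            (fredholmTransform (fullKernel h) z) (Sum.inl i) q.1 q.2
          + ∑ j, ∫ s in (entryTimeFrom Λ t0 (Sum.inl i) q.1 q.2)..q.1,
              sourceMatrix g Gpm s (chi Λ (Sum.inl i) s q.1 q.2) (Sum.inl i) j
                * fredholmTransform (fullKernel h) z s 0 j := by
  filter_upwards [hz.ae_inflowValue_inl_eq hh hl hg hF ht0 i,
    ae_restrict_mem (measurableSet_Ioi.prod measurableSet_Ioo)] with q hinflow hmem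
  obtain ⟨ht, hx⟩ : t0 < q.1 ∧ q.2 ∈ Ioo (0 : ℝ) 1 := hmem
  have hq := ((hl i).flow_mem_Icc_iff 0 1 q.1 q.2 q.1).1
    (by rw [(hl i).flow_self]; exact Ioo_subset_Icc_self hx)
  have hchi : ∀ s ∈ Icc (entryTimeFrom Λ t0 (Sum.inl i) q.1 q.2) q.1,
      chi Λ (Sum.inl i) s q.1 q.2 ∈ Icc (0 : ℝ) 1 := fun s hs =>
    ((hl i).flow_mem_Icc_iff 0 1 q.1 q.2 s).2
      ⟨(le_max_right _ _).trans hs.1, hs.2.trans hq.2⟩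
  have hentry : entryTimeFrom Λ t0 (Sum.inl i) q.1 q.2 ∈ Icc t0 q.1 :=
    ⟨le_max_left _ _, max_le (le_of_lt ht) hq.1⟩
  rw [hinflow, hz.sum_integral_sourceMatrix_eq hh hl hg ht0 i hentry hchi,
    hz.fredholmTransform_inl_eq hh hl hg ht0 (le_of_lt ht) (Ioo_subset_Icc_self hx)
      (Or.inr hx.1) i]
  ring

lemma ae_equation_inr (hz : IsBroadSolution Λ 0 (targetMatrix Gpm) 0 Q t0 z0 z)
    (hh : IsKernelSolution Λ g h) (hl : ∀ i : Fin m, NegativeSpeed (Λ (Sum.inl i)) C K ε)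
    (hg : ∀ i j, ContBddStrip fun t x => g t x i j) (ht0 : 0 ≤ t0)
    (F : ℝ → ℝ → Matrix (Fin m) (StateIdx m p) ℝ) (k : Fin p) :
    ∀ᵐ q : ℝ × ℝ ∂(volume.restrict (Ioi t0 ×ˢ Ioo 0 1)),
      fredholmTransform (fullKernel h) z q.1 q.2 (Sum.inr k)
        = inflowValue Λ F Q t0 (fredholmSlice (fullKernel h t0) z0)
            (fredholmTransform (fullKernel h) z) (Sum.inr k) q.1 q.2
          + ∑ j, ∫ s in (entryTimeFrom Λ t0 (Sum.inr k) q.1 q.2)..q.1,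
              sourceMatrix g Gpm s (chi Λ (Sum.inr k) s q.1 q.2) (Sum.inr k) j
                * fredholmTransform (fullKernel h) z s 0 j := by
  have hzero := fun {s} => hz.fredholmTransform_zero hh hl hg ht0 (t := s)
  filter_upwards [hz.equation (Sum.inr k),
    ae_restrict_mem (measurableSet_Ioi.prod measurableSet_Ioo)] with q hq hmem
  have hinflow : inflowValue Λ F Q t0 (fredholmSlice (fullKernel h t0) z0)
        (fredholmTransform (fullKernel h) z) (Sum.inr k) q.1 q.2
      = inflowValue Λ 0 Q t0 z0 z (Sum.inr k) q.1 q.2 := by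
    simp only [inflowValue]
    split_ifs with hentry
    · simp only [hzero hentry]
    · exact fredholmSlice_fullKernel_inr h t0 z0 _ k
  have hγ : fredholmTransform (fullKernel h) z q.1 q.2 (Sum.inr k) = z q.1 q.2 (Sum.inr k) :=
    fredholmSlice_fullKernel_inr h q.1 (z q.1) q.2 k
  rw [hγ, hq, hinflow]
  simp only [Pi.zero_apply, Matrix.zero_apply, zero_mul, intervalIntegral.integral_zero,
    Finset.sum_const_zero, add_zero, add_right_inj]
  refine Finset.sum_congr rfl fun j _ => intervalIntegral.integral_congr_ae
    (ae_of_all _ fun s hs => ?_)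
  have hts : t0 < s := (le_min (le_max_left _ _) (le_of_lt hmem.1)).trans_lt hs.1
  rw [hzero hts, sourceMatrix, targetMatrix]
  rfl

end IsBroadSolution

end BoundaryCoupling

theorem propositionA4_general {m p : ℕ} {Λ : StateIdx m p → ℝ → ℝ → ℝ} {C K ε : ℝ}
    (hΛ : SignedSpeeds Λ C K ε) {Q : ℝ → Matrix (Fin p) (Fin m) ℝ}
    {Gmm : ℝ → ℝ → Matrix (Fin m) (Fin m) ℝ}
    (hGmm : ∀ i j, ContBddStrip (fun t x => Gmm t x i j))
    {Gpm : ℝ → ℝ → Matrix (Fin p) (Fin m) ℝ}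
    {h : ℝ → ℝ → ℝ → Matrix (Fin m) (Fin m) ℝ} (hh : IsKernelSolution Λ Gmm h)
    {F : ℝ → ℝ → Matrix (Fin m) (StateIdx m p) ℝ} (hF : IsGainSolution (fullKernel h) F)
    {t0 : ℝ} (ht0 : 0 ≤ t0) {z0 : ℝ → StateIdx m p → ℝ} {z : ℝ → ℝ → StateIdx m p → ℝ}
    (hz : IsBroadSolution Λ 0 (targetMatrix Gpm) 0 Q t0 z0 z) :
    IsBroadSolution Λ 0 (sourceMatrix Gmm Gpm) F Q t0
      (fredholmSlice (fullKernel h t0) z0) (fredholmTransform (fullKernel h) z) where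
  initial_memLp := hh.memLp_fredholmSlice_initialTime hΛ.negativeSpeed hGmm ht0 one_le_two
    hz.initial_memLp
  regularity := hz.broadRegularity_fredholmTransform hh hΛ.negativeSpeed hGmm ht0
  equation i := by
    simp only [Pi.zero_apply, Matrix.zero_apply, zero_mul, intervalIntegral.integral_zero,
      Finset.sum_const_zero, add_zero]
    rcases i with i | k
    · exact hz.ae_equation_inl hh hΛ.negativeSpeed hGmm hF ht0 i
    · exact hz.ae_equation_inr hh hΛ.negativeSpeed hGmm ht0 F k

theorem propositionA4 {m p : ℕ} (hm : 1 ≤ m) (hp : 1 ≤ p)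
    (Λ : StateIdx m p → ℝ → ℝ → ℝ) (hΛ : AdmissibleSpeeds Λ)
    (Q : ℝ → Matrix (Fin p) (Fin m) ℝ) (hQ : ∀ i j, ContBddHalfLine (fun t => Q t i j))
    (Gmm : ℝ → ℝ → Matrix (Fin m) (Fin m) ℝ)
    (hGmm : ∀ i j, ContBddStrip (fun t x => Gmm t x i j))
    (hGmm_tri : ∀ t ≥ 0, ∀ x ∈ Set.Icc (0 : ℝ) 1, ∀ i j, i ≤ j → Gmm t x i j = 0)
    (Gpm : ℝ → ℝ → Matrix (Fin p) (Fin m) ℝ)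
    (hGpm : ∀ i j, ContBddStrip (fun t x => Gpm t x i j))
    (h : ℝ → ℝ → ℝ → Matrix (Fin m) (Fin m) ℝ) (hh : IsKernelSolution Λ Gmm h)
    (F : ℝ → ℝ → Matrix (Fin m) (StateIdx m p) ℝ) (hF : IsGainSolution (fullKernel h) F)
    (t0 : ℝ) (ht0 : 0 ≤ t0)
    (z0 : ℝ → StateIdx m p → ℝ)
    (hz0 : ∀ i, MeasureTheory.MemLp (fun x => z0 x i) 2
      (MeasureTheory.volume.restrict (Set.Ioo 0 1)))
    (z : ℝ → ℝ → StateIdx m p → ℝ)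
    (hz : IsBroadSolution Λ 0 (targetMatrix Gpm) 0 Q t0 z0 z) :
    IsBroadSolution Λ 0 (sourceMatrix Gmm Gpm) F Q t0
      (fredholmSlice (fullKernel h t0) z0) (fredholmTransform (fullKernel h) z) := by
  obtain ⟨C, K, ε, hΛ'⟩ := hΛ.exists_signedSpeeds
  exact propositionA4_general hΛ' hGmm hh hF ht0 hz
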